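/- Let $\mathfrak{g}$ be a finite-dimensional real Lie algebra that is almost abelian with structure matrix $A$: there are a codimension-one abelian ideal $\mathfrak{u}$ of $\mathfrak{g}$, a vector $f_1\in\mathfrak{g}\setminus\mathfrak{u}$ and a basis of $\mathfrak{u}$, identifying $\mathfrak{u}$ with $\mathbb{R}^m$, such that $[f_1,u]=Au$ for all $u\in\mathfrak{u}$, where $A\in M_m(\mathbb{R})$; so $\mathfrak{g}=\mathfrak{g}_A=\mathbb{R}f_1\ltimes_A\mathbb{R}^m$. Assume that $\mathfrak{g}$ is unimodular ($\operatorname{tr}(\operatorname{ad}_x)=0$ for all $x\in\mathfrak{g}$) and completely solvable ($\mathfrak{g}$ is solvable and, for every $x\in\mathfrak{g}$, all eigenvalues of $\operatorname{ad}_x$ in $\mathbb{C}$ are real). Let $(\bigwedge^*\mathfrak{g}^*,d)$ be the Chevalley–Eilenberg complex, whose differential is the graded derivation of degree $1$ with $d\theta(x,y)=-\theta([x,y])$ for $\theta\in\mathfrak{g}^*$, and let $H^*(\mathfrak{g})$ be its cohomology. Let $\omega$ be a symplectic form on $\mathfrak{g}$, i.e. a non-degenerate $2$-form $\omega\in\bigwedge^2\mathfrak{g}^*$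 with $d\omega=0$, and write $\dim\mathfrak{g}=2n$. Then $\omega$ satisfies the hard-Lefschetz condition, i.e. for every $0\le k\le n$ the Lefschetz operator $$L_k:H^{n-k}(\mathfrak{g})\to H^{n+k}(\mathfrak{g}),\qquad L_k([\alpha])=[\omega^k\wedge\alpha],$$ is a linear isomorphism, if and only if $A$ is semisimple (every $A$-invariant subspace of $\mathbb{R}^m$ has an $A$-invariant complement). -/

import Mathlib

namespace LieForm

noncomputable section

section Complex

variable (𝔤 : Type*) [LieRing 𝔤] [LieAlgebra ℝ 𝔤]

/-- The algebra `⋀ 𝔤*` of (left-invariant) forms on `𝔤`; the product is the wedge product, and the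
`k`-forms are the elements of `⋀[ℝ]^k (Module.Dual ℝ 𝔤)`. -/
abbrev Form : Type _ := ExteriorAlgebra ℝ (Module.Dual ℝ 𝔤)

variable {𝔤}

/-- A covector, regarded as a `1`-form. -/
abbrev oneForm (θ : Module.Dual ℝ 𝔤) : Form 𝔤 := ExteriorAlgebra.ι ℝ θ

/-- Interior product of a form with the vector `x`. -/
def contr (x : 𝔤) : Form 𝔤 →ₗ[ℝ] Form 𝔤 :=
  CliffordAlgebra.contractLeft (Module.Dual.eval ℝ 𝔤 x)

/-- The value `η(x, y)` of a `2`-form `η`. -/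
def eval₂ (η : Form 𝔤) (x y : 𝔤) : ℝ :=
  ExteriorAlgebra.algebraMapInv (contr y (contr x η))

theorem contr_algebraMap (x : 𝔤) (r : ℝ) : contr x (algebraMap ℝ (Form 𝔤) r) = 0 :=
  CliffordAlgebra.contractLeft_algebraMap _ (Module.Dual.eval ℝ 𝔤 x) r

theorem contr_oneForm (x : 𝔤) (θ : Module.Dual ℝ 𝔤) :
    contr x (oneForm θ) = algebraMap ℝ (Form 𝔤) (θ x) :=
  CliffordAlgebra.contractLeft_ι _ (Module.Dual.eval ℝ 𝔤 x) θ

theorem contr_oneForm_mul (x : 𝔤) (θ : Module.Dual ℝ 𝔤) (β : Form 𝔤) :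
    contr x (oneForm θ * β) = θ x • β - oneForm θ * contr x β :=
  CliffordAlgebra.contractLeft_ι_mul _ _ _

/-- On a product of two covectors, `eval₂` is the determinant, with no numerical factor. -/
theorem eval₂_mul (θ η : Module.Dual ℝ 𝔤) (x y : 𝔤) :
    eval₂ (oneForm θ * oneForm η) x y = θ x * η y - θ y * η x := by
  unfold eval₂
  rw [contr_oneForm_mul, contr_oneForm, map_sub, map_smul, contr_oneForm, contr_oneForm_mul,
    contr_algebraMap]
  simp [ExteriorAlgebra.algebraMapInv]

theorem oneForm_mul_comm {k : ℕ} {α : Form 𝔤} (hα : α ∈ ⋀[ℝ]^k (Module.Dual ℝ 𝔤))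
    (θ : Module.Dual ℝ 𝔤) : oneForm θ * α = (-1 : ℝ) ^ k • (α * oneForm θ) := by
  induction hα using Submodule.pow_induction_on_left' with
  | algebraMap r => simp [Algebra.commutes]
  | add x y i hx hy h1 h2 => rw [mul_add, add_mul, h1, h2, smul_add]
  | mem_mul m hm i x hx h =>
    obtain ⟨η, rfl⟩ := hm
    have h0 : oneForm θ * oneForm η = - (oneForm η * oneForm θ) :=
      eq_neg_of_add_eq_zero_left (ExteriorAlgebra.ι_add_mul_swap θ η)
    rw [← mul_assoc, h0, neg_mul, mul_assoc, h, pow_succ]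
    simp [mul_assoc]

theorem contr_mul {k : ℕ} {α : Form 𝔤} (hα : α ∈ ⋀[ℝ]^k (Module.Dual ℝ 𝔤)) (x : 𝔤)
    (β : Form 𝔤) : contr x (α * β) = contr x α * β + (-1 : ℝ) ^ k • (α * contr x β) := by
  induction hα using Submodule.pow_induction_on_left' with
  | algebraMap r =>
    rw [contr_algebraMap, Algebra.algebraMap_eq_smul_one]
    simp
  | add a b i ha hb h1 h2 =>
    rw [add_mul, map_add, h1, h2, map_add, add_mul, add_mul, smul_add]; abel
  | mem_mul m hm i a ha h =>
    obtain ⟨η, rfl⟩ := hm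
    rw [mul_assoc, contr_oneForm_mul, h, contr_oneForm_mul, pow_succ]
    simp only [mul_add, sub_mul, mul_assoc, mul_smul_comm, smul_mul_assoc]
    module

theorem oneForm_mul_mem {k : ℕ} {α : Form 𝔤} (hα : α ∈ ⋀[ℝ]^k (Module.Dual ℝ 𝔤))
    (θ : Module.Dual ℝ 𝔤) : oneForm θ * α ∈ ⋀[ℝ]^(k + 1) (Module.Dual ℝ 𝔤) := by
  have h := Submodule.mul_mem_mul
    (LinearMap.mem_range_self (ExteriorAlgebra.ι ℝ (M := Module.Dual ℝ 𝔤)) θ) hα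
  rw [← pow_succ'] at h
  exact h

theorem oneForm_mem (θ : Module.Dual ℝ 𝔤) : oneForm θ ∈ ⋀[ℝ]^1 (Module.Dual ℝ 𝔤) := by
  rw [ExteriorAlgebra.exteriorPower, pow_one]; exact LinearMap.mem_range_self _ θ

theorem oneForm_mul_contr_mem {k : ℕ} {α : Form 𝔤} (hα : α ∈ ⋀[ℝ]^k (Module.Dual ℝ 𝔤))
    (θ : Module.Dual ℝ 𝔤) (x : 𝔤) :
    oneForm θ * contr x α ∈ ⋀[ℝ]^k (Module.Dual ℝ 𝔤) := by
  induction hα using Submodule.pow_induction_on_left' generalizing θ with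
  | algebraMap r => rw [contr_algebraMap, mul_zero]; exact Submodule.zero_mem _
  | add a b i ha hb h1 h2 =>
    rw [map_add, mul_add]; exact Submodule.add_mem _ (h1 θ) (h2 θ)
  | mem_mul m hm i a ha h =>
    obtain ⟨η, rfl⟩ := hm
    rw [contr_oneForm_mul, mul_sub, mul_smul_comm]
    exact Submodule.sub_mem _ (Submodule.smul_mem _ _ (oneForm_mul_mem ha θ))
      (oneForm_mul_mem (h η) θ)

variable [FiniteDimensional ℝ 𝔤]

/-- The exterior derivative on `⋀ 𝔤*`, `dα = -½ ∑ i j, eⁱ ∧ eʲ ∧ ι_{[eᵢ, eⱼ]} α` in a basis `e` of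
`𝔤`. By `eval₂_d_oneForm` and `d_mul` it is the graded derivation of degree one
with `dθ(x, y) = -θ([x, y])`, so it does not depend on the basis. -/
def d : Form 𝔤 →ₗ[ℝ] Form 𝔤 :=
  -(1 / 2 : ℝ) • ∑ i, ∑ j,
    LinearMap.mulLeft ℝ (oneForm ((Module.finBasis ℝ 𝔤).coord i) *
      oneForm ((Module.finBasis ℝ 𝔤).coord j)) ∘ₗ
        contr ⁅Module.finBasis ℝ 𝔤 i, Module.finBasis ℝ 𝔤 j⁆

theorem d_apply (α : Form 𝔤) :
    d α = -(1 / 2 : ℝ) • ∑ i, ∑ j, oneForm ((Module.finBasis ℝ 𝔤).coord i) *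
      oneForm ((Module.finBasis ℝ 𝔤).coord j) *
        contr ⁅Module.finBasis ℝ 𝔤 i, Module.finBasis ℝ 𝔤 j⁆ α := by
  simp [d, LinearMap.sum_apply, mul_assoc]

theorem d_algebraMap (r : ℝ) : d (algebraMap ℝ (Form 𝔤) r) = 0 := by
  simp [d_apply, contr_algebraMap]

/-- `d (α ∧ β) = dα ∧ β + (-1)ᵏ α ∧ dβ` for a `k`-form `α`. -/
theorem d_mul {k : ℕ} {α : Form 𝔤} (hα : α ∈ ⋀[ℝ]^k (Module.Dual ℝ 𝔤)) (β : Form 𝔤) :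
    d (α * β) = d α * β + (-1 : ℝ) ^ k • (α * d β) := by
  have key : ∀ i j, oneForm ((Module.finBasis ℝ 𝔤).coord i) *
      oneForm ((Module.finBasis ℝ 𝔤).coord j) * α = α *
      (oneForm ((Module.finBasis ℝ 𝔤).coord i) * oneForm ((Module.finBasis ℝ 𝔤).coord j)) := by
    intro i j
    rw [mul_assoc, oneForm_mul_comm hα, mul_smul_comm, ← mul_assoc, oneForm_mul_comm hα,
      smul_mul_assoc, smul_smul, ← mul_pow, mul_assoc]
    simp
  simp only [d_apply, contr_mul hα, mul_add, Finset.sum_add_distrib, smul_add, mul_smul_comm,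
    smul_mul_assoc, Finset.sum_mul, Finset.mul_sum, mul_assoc]
  congr 1
  rw [smul_comm]
  congr 1
  rw [Finset.smul_sum]
  refine Finset.sum_congr rfl fun i _ => ?_
  rw [Finset.smul_sum]
  refine Finset.sum_congr rfl fun j _ => ?_
  congr 1
  rw [← mul_assoc, ← mul_assoc, key, mul_assoc, mul_assoc]

theorem sum_coord_oneForm (φ : Module.Dual ℝ 𝔤) :
    oneForm φ = ∑ l, φ (Module.finBasis ℝ 𝔤 l) • oneForm ((Module.finBasis ℝ 𝔤).coord l) := by
  have h : φ = ∑ l, φ (Module.finBasis ℝ 𝔤 l) • (Module.finBasis ℝ 𝔤).coord l :=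
    ((Module.finBasis ℝ 𝔤).sum_dual_apply_smul_coord φ).symm
  unfold oneForm
  conv_lhs => rw [h]
  rw [map_sum]
  simp only [map_smul]

theorem contr_d_oneForm (θ : Module.Dual ℝ 𝔤) (x : 𝔤) :
    contr x (d (oneForm θ)) = -oneForm (θ ∘ₗ (LieAlgebra.ad ℝ 𝔤 x : 𝔤 →ₗ[ℝ] 𝔤)) := by
  have hx : ∀ y, θ ⁅x, y⁆ =
      ∑ i, (Module.finBasis ℝ 𝔤).coord i x * θ ⁅Module.finBasis ℝ 𝔤 i, y⁆ := by
    intro y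
    have h := congrArg (fun z => θ ⁅z, y⁆) ((Module.finBasis ℝ 𝔤).sum_repr x)
    simp only [sum_lie, map_sum, smul_lie, map_smul, smul_eq_mul] at h
    exact h.symm
  have h1 : ∑ i, ∑ j, (θ ⁅Module.finBasis ℝ 𝔤 i, Module.finBasis ℝ 𝔤 j⁆ *
      (Module.finBasis ℝ 𝔤).coord i x) • oneForm ((Module.finBasis ℝ 𝔤).coord j) =
      oneForm (θ ∘ₗ (LieAlgebra.ad ℝ 𝔤 x : 𝔤 →ₗ[ℝ] 𝔤)) := by
    rw [Finset.sum_comm, sum_coord_oneForm (θ ∘ₗ (LieAlgebra.ad ℝ 𝔤 x : 𝔤 →ₗ[ℝ] 𝔤))]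
    refine Finset.sum_congr rfl fun j _ => ?_
    rw [← Finset.sum_smul, LinearMap.comp_apply, LieAlgebra.ad_apply, hx]
    simp only [mul_comm]
  have h2 : ∑ i, ∑ j, (θ ⁅Module.finBasis ℝ 𝔤 i, Module.finBasis ℝ 𝔤 j⁆ *
      (Module.finBasis ℝ 𝔤).coord j x) • oneForm ((Module.finBasis ℝ 𝔤).coord i) =
      -oneForm (θ ∘ₗ (LieAlgebra.ad ℝ 𝔤 x : 𝔤 →ₗ[ℝ] 𝔤)) := by
    rw [← h1, Finset.sum_comm, ← Finset.sum_neg_distrib]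
    refine Finset.sum_congr rfl fun j _ => ?_
    rw [← Finset.sum_neg_distrib]
    refine Finset.sum_congr rfl fun i _ => ?_
    rw [← lie_skew, map_neg, neg_mul, neg_smul]
  have h3 : ∀ i j, contr x (oneForm ((Module.finBasis ℝ 𝔤).coord i) *
      oneForm ((Module.finBasis ℝ 𝔤).coord j) *
        contr ⁅Module.finBasis ℝ 𝔤 i, Module.finBasis ℝ 𝔤 j⁆ (oneForm θ)) =
      (θ ⁅Module.finBasis ℝ 𝔤 i, Module.finBasis ℝ 𝔤 j⁆ *
        (Module.finBasis ℝ 𝔤).coord i x) • oneForm ((Module.finBasis ℝ 𝔤).coord j) -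
      (θ ⁅Module.finBasis ℝ 𝔤 i, Module.finBasis ℝ 𝔤 j⁆ *
        (Module.finBasis ℝ 𝔤).coord j x) • oneForm ((Module.finBasis ℝ 𝔤).coord i) := by
    intro i j
    rw [contr_oneForm, Algebra.algebraMap_eq_smul_one, mul_smul_comm, mul_one, map_smul,
      contr_oneForm_mul, contr_oneForm, Algebra.algebraMap_eq_smul_one, mul_smul_comm, mul_one,
      smul_sub, smul_smul, smul_smul]
  rw [d_apply, map_smul, map_sum]
  simp only [map_sum, h3, Finset.sum_sub_distrib]
  rw [h1, h2]
  module

/-- `dθ(x, y) = -θ([x, y])`. -/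
theorem eval₂_d_oneForm (θ : Module.Dual ℝ 𝔤) (x y : 𝔤) :
    eval₂ (d (oneForm θ)) x y = -θ ⁅x, y⁆ := by
  unfold eval₂
  rw [contr_d_oneForm, map_neg, contr_oneForm, map_neg]
  simp [ExteriorAlgebra.algebraMapInv]

/-- `d` raises the degree by one. -/
theorem d_mem {k : ℕ} {α : Form 𝔤} (hα : α ∈ ⋀[ℝ]^k (Module.Dual ℝ 𝔤)) :
    d α ∈ ⋀[ℝ]^(k + 1) (Module.Dual ℝ 𝔤) := by
  rw [d_apply]
  refine Submodule.smul_mem _ _ (Submodule.sum_mem _ fun i _ => Submodule.sum_mem _ fun j _ => ?_)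
  rw [mul_assoc]
  exact oneForm_mul_mem (oneForm_mul_contr_mem hα _ _) _

theorem cyclic_sum_eq_zero {ι V : Type*} [Fintype ι] [AddCommGroup V] [Module ℝ V]
    (c : ι → ι → ι → ℝ) (F : ι → ι → ι → V) (hF : ∀ i j l, F j l i = F i j l)
    (hc : ∀ i j l, c i j l + c j l i + c l i j = 0) : ∑ i, ∑ j, ∑ l, c i j l • F i j l = 0 := by
  have hsum : ∀ g : ι → ι → ι → V, ∑ i, ∑ j, ∑ l, g i j l = ∑ i, ∑ j, ∑ l, g j l i := by
    intro g
    rw [Finset.sum_comm (f := fun i j => ∑ l, g j l i)]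
    refine Finset.sum_congr rfl fun j _ => ?_
    rw [Finset.sum_comm]
  have h1 := hsum fun i j l => c i j l • F i j l
  have h2 := hsum fun i j l => c j l i • F i j l
  simp only [hF] at h1 h2
  have h3 : ∑ i, ∑ j, ∑ l, c i j l • F i j l + ∑ i, ∑ j, ∑ l, c j l i • F i j l +
      ∑ i, ∑ j, ∑ l, c l i j • F i j l = 0 := by
    simp only [← Finset.sum_add_distrib, ← add_smul, hc, zero_smul, Finset.sum_const_zero]
  rw [← h2, ← h1] at h3
  generalize ∑ i, ∑ j, ∑ l, c i j l • F i j l = T at h3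
  have h' : (3 : ℝ) • T = 0 := by rw [← h3]; module
  exact (smul_eq_zero.mp h').resolve_left (by norm_num)

theorem d_d_oneForm (θ : Module.Dual ℝ 𝔤) : d (d (oneForm θ)) = 0 := by
  rw [d_apply (d (oneForm θ))]
  simp only [contr_d_oneForm]
  simp only [sum_coord_oneForm (θ ∘ₗ _), mul_neg, Finset.sum_neg_distrib, Finset.mul_sum,
    mul_smul_comm, mul_assoc, LinearMap.comp_apply]
  rw [cyclic_sum_eq_zero, neg_zero, smul_zero]
  · intro i j l
    have h := oneForm_mul_comm (oneForm_mul_mem (oneForm_mem ((Module.finBasis ℝ 𝔤).coord l))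
      ((Module.finBasis ℝ 𝔤).coord j)) ((Module.finBasis ℝ 𝔤).coord i)
    rw [h, mul_assoc]
    norm_num
  · intro i j l
    have h := lie_jacobi (Module.finBasis ℝ 𝔤 i) (Module.finBasis ℝ 𝔤 j) (Module.finBasis ℝ 𝔤 l)
    rw [← lie_skew _ ⁅Module.finBasis ℝ 𝔤 j, Module.finBasis ℝ 𝔤 l⁆,
      ← lie_skew _ ⁅Module.finBasis ℝ 𝔤 l, Module.finBasis ℝ 𝔤 i⁆,
      ← lie_skew _ ⁅Module.finBasis ℝ 𝔤 i, Module.finBasis ℝ 𝔤 j⁆] at h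
    have h' := congrArg θ h
    simp only [map_add, map_neg, map_zero] at h'
    simp only [LieAlgebra.ad_apply]
    linarith

/-- `d ∘ d = 0`. -/
theorem d_d {k : ℕ} {α : Form 𝔤} (hα : α ∈ ⋀[ℝ]^k (Module.Dual ℝ 𝔤)) : d (d α) = 0 := by
  induction hα using Submodule.pow_induction_on_left' with
  | algebraMap r => rw [d_algebraMap, map_zero]
  | add a b i ha hb h1 h2 => rw [map_add, map_add, h1, h2, add_zero]
  | mem_mul m hm i a ha h =>
    obtain ⟨η, rfl⟩ := hm
    have h1 := oneForm_mem η
    rw [d_mul h1, map_add, map_smul, d_mul h1, d_mul (d_mem h1), h, d_d_oneForm]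
    simp

variable (𝔤) in
/-- The closed `k`-forms. -/
def closedForms (k : ℕ) : Submodule ℝ (Form 𝔤) :=
  ⋀[ℝ]^k (Module.Dual ℝ 𝔤) ⊓ LinearMap.ker d

variable (𝔤) in
/-- The exact `k`-forms, `d (⋀ᵏ⁻¹ 𝔤*)`; only `0` is exact in degree `0`. -/
def exactForms : ℕ → Submodule ℝ (Form 𝔤)
  | 0 => ⊥
  | k + 1 => (⋀[ℝ]^k (Module.Dual ℝ 𝔤)).map d

theorem mem_exactForms {k : ℕ} {η : Form 𝔤} :
    η ∈ exactForms 𝔤 k ↔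
      η = 0 ∨ ∃ j, j + 1 = k ∧ ∃ β ∈ ⋀[ℝ]^j (Module.Dual ℝ 𝔤), d β = η := by
  cases k with
  | zero => simp [exactForms]
  | succ k =>
    simp only [exactForms, Submodule.mem_map, Nat.add_right_cancel_iff, exists_eq_left]
    refine ⟨Or.inr, ?_⟩
    rintro (rfl | h)
    · exact ⟨0, Submodule.zero_mem _, map_zero _⟩
    · exact h

theorem exactForms_le_closedForms (k : ℕ) : exactForms 𝔤 k ≤ closedForms 𝔤 k := by
  intro η hη
  rcases mem_exactForms.mp hη with rfl | ⟨j, rfl, β, hβ, rfl⟩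
  · exact Submodule.zero_mem _
  · exact ⟨d_mem hβ, d_d hβ⟩

variable (𝔤) in
/-- The Lie algebra cohomology `Hᵏ(𝔤)` with trivial real coefficients: closed `k`-forms modulo
exact `k`-forms. -/
abbrev Cohomology (k : ℕ) : Type _ :=
  closedForms 𝔤 k ⧸ (exactForms 𝔤 k).submoduleOf (closedForms 𝔤 k)

variable (𝔤) in
/-- A symplectic form on `𝔤`: a closed non-degenerate element of `⋀² 𝔤*`. -/
structure SymplecticForm where
  form : Form 𝔤
  mem : form ∈ ⋀[ℝ]^2 (Module.Dual ℝ 𝔤)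
  closed : d form = 0
  nondegenerate : ∀ x : 𝔤, (∀ y : 𝔤, eval₂ form x y = 0) → x = 0

namespace SymplecticForm

variable (ω : SymplecticForm 𝔤)

theorem pow_mem (r : ℕ) : ω.form ^ r ∈ ⋀[ℝ]^(2 * r) (Module.Dual ℝ 𝔤) := by
  rw [ExteriorAlgebra.exteriorPower, pow_mul]
  exact Submodule.pow_mem_pow _ ω.mem r

theorem d_pow_mul (r : ℕ) (α : Form 𝔤) : d (ω.form ^ r * α) = ω.form ^ r * d α := by
  induction r with
  | zero => simp
  | succ r ih => rw [pow_succ', mul_assoc, d_mul ω.mem, ω.closed, ih, mul_assoc]; simp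

theorem pow_mul_mem (r : ℕ) {p : ℕ} {α : Form 𝔤} (hα : α ∈ ⋀[ℝ]^p (Module.Dual ℝ 𝔤)) :
    ω.form ^ r * α ∈ ⋀[ℝ]^(p + 2 * r) (Module.Dual ℝ 𝔤) := by
  rw [add_comm, ExteriorAlgebra.exteriorPower, pow_add]
  exact Submodule.mul_mem_mul (ω.pow_mem r) hα

/-- The map `α ↦ ωʳ ∧ α` on closed `p`-forms. -/
def mulClosed (r p : ℕ) : closedForms 𝔤 p →ₗ[ℝ] closedForms 𝔤 (p + 2 * r) :=
  (LinearMap.mulLeft ℝ (ω.form ^ r)).restrict fun α hα =>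
    ⟨ω.pow_mul_mem r hα.1, by
      have h : d α = 0 := hα.2
      change d (ω.form ^ r * α) = 0
      rw [d_pow_mul, h, mul_zero]⟩

/-- The Lefschetz operator `Hᵖ(𝔤) → Hᵖ⁺²ʳ(𝔤)`, `[α] ↦ [ωʳ ∧ α]`. -/
def lefschetz (r p : ℕ) : Cohomology 𝔤 p →ₗ[ℝ] Cohomology 𝔤 (p + 2 * r) :=
  Submodule.mapQ _ _ (ω.mulClosed r p) fun α hα => by
    change ω.form ^ r * (α : Form 𝔤) ∈ exactForms 𝔤 (p + 2 * r)
    have hα' : (α : Form 𝔤) ∈ exactForms 𝔤 p := hα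
    rcases mem_exactForms.mp hα' with h | ⟨j, hj, β, hβ, h⟩
    · refine mem_exactForms.mpr (Or.inl ?_)
      rw [h, mul_zero]
    · refine mem_exactForms.mpr (Or.inr ⟨j + 2 * r, by omega, ω.form ^ r * β,
        ω.pow_mul_mem r hβ, ?_⟩)
      rw [d_pow_mul, h]

/-- The hard-Lefschetz condition: with `dim 𝔤 = 2n`, the operator
`[α] ↦ [ωʳ ∧ α] : Hⁿ⁻ʳ(𝔤) → Hⁿ⁺ʳ(𝔤)` is bijective for all `0 ≤ r ≤ n`. Here `p = n - r`, so that
`n + r = p + 2 * r`. -/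
def HardLefschetz : Prop :=
  ∀ r p : ℕ, 2 * (p + r) = Module.finrank ℝ 𝔤 → Function.Bijective (ω.lefschetz r p)

end SymplecticForm

end Complex

section AlmostAbelian

variable (𝔤 : Type*) [LieRing 𝔤] [LieAlgebra ℝ 𝔤]

/-- `𝔤` is almost abelian with structure matrix `A`: it has a codimension-one abelian ideal `𝔲`,
a complementary vector `f₁`, and a basis of `𝔲` in which the action of `f₁` has
matrix `A`, that is `𝔤 = ℝ f₁ ⋉_A ℝᵐ`. -/
def IsAlmostAbelian {m : ℕ} (A : Matrix (Fin m) (Fin m) ℝ) : Prop :=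
  ∃ (𝔲 : LieIdeal ℝ 𝔤) (f₁ : 𝔤) (b : Module.Basis (Fin m) ℝ 𝔲),
    IsLieAbelian 𝔲 ∧ Module.finrank ℝ (𝔤 ⧸ 𝔲) = 1 ∧ f₁ ∉ 𝔲 ∧
      ∀ j, ⁅f₁, (b j : 𝔤)⁆ = ∑ i, A i j • (b i : 𝔤)

/-- `𝔤` is unimodular: `tr (ad x) = 0` for all `x`. -/
def IsUnimodular : Prop :=
  ∀ x : 𝔤, LinearMap.trace ℝ 𝔤 (LieAlgebra.ad ℝ 𝔤 x) = 0

/-- `𝔤` is completely solvable: it is solvable and every `ad x` has only real eigenvalues. -/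
def IsCompletelySolvable [FiniteDimensional ℝ 𝔤] : Prop :=
  LieAlgebra.IsSolvable 𝔤 ∧ ∀ (x : 𝔤) (z : ℂ),
    ((LieAlgebra.ad ℝ 𝔤 x : 𝔤 →ₗ[ℝ] 𝔤).charpoly.map (algebraMap ℝ ℂ)).IsRoot z → z.im = 0

end AlmostAbelian

/-- A real square matrix is semisimple if every invariant subspace has an invariant
complement. -/
def IsSemisimpleMatrix {m : ℕ} (A : Matrix (Fin m) (Fin m) ℝ) : Prop :=
  Module.End.IsSemisimple (Matrix.toLin' A)

end

end LieForm

/-! Write `𝔤 = ℝ f ⋉ ker τ` with `ker τ` abelian and `τ f = 1`. Then `d = τ ∧ L_f`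
(`IsSplitting.d_eq`), so the cohomology is governed by the Lie derivative `L_f`. Let `v` satisfy
`ω(v, ·) = τ`. Unimodularity gives `[f, v] = 0` (`lie_dual_vector`). If moreover `v` is not in the
image of `ad f`, then `f` can be moved within `f + ker τ`, without changing `A`, so that `L_f ω = 0`
(`exists_adapted_splitting`).

Hard Lefschetz implies `A` semisimple: `v = [f, w]` would put the nonzero class of `τ` in the kernel
of the Lefschetz operator on `H¹` (`lie_ne_dual_vector`), so `f` can be adapted. A nontrivial Jordan
block of `ad f` would then give a nonzero class in degree 1 (eigenvalue `0`) or degree 2 (eigenvalue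
`μ ≠ 0`, paired with `-μ`) killed by a Lefschetz operator. Complete solvability puts all eigenvalues
in `ℝ`, so trivial Jordan blocks mean that `ad f` is diagonalizable.

`A` semisimple implies hard Lefschetz: `v = [f, w]` with `[f, v] = 0` would be a Jordan block, so
`f` can again be adapted, and `ad f` is diagonalizable. Hence `L_f` is diagonalizable on forms and
each cohomology class has exactly one `L_f`-invariant representative. Wedging with `ω` commutes with
`L_f`, so the Lefschetz isomorphism of linear algebra restricts to invariant forms. -/

namespace LieForm

noncomputable section

/-! ### Interior products and degrees of forms -/

section Contraction

variable {𝔤 : Type*} [LieRing 𝔤] [LieAlgebra ℝ 𝔤]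

theorem contr_comm (x y : 𝔤) (α : Form 𝔤) : contr x (contr y α) = -contr y (contr x α) :=
  CliffordAlgebra.contractLeft_comm _ _ _

theorem contr_add_left (x y : 𝔤) (α : Form 𝔤) : contr (x + y) α = contr x α + contr y α := by
  simp [contr]

theorem contr_smul_left (r : ℝ) (x : 𝔤) (α : Form 𝔤) : contr (r • x) α = r • contr x α := by
  simp [contr]

theorem mul_mem_exteriorPower {p q : ℕ} {α β : Form 𝔤} (hα : α ∈ ⋀[ℝ]^p (Module.Dual ℝ 𝔤))
    (hβ : β ∈ ⋀[ℝ]^q (Module.Dual ℝ 𝔤)) : α * β ∈ ⋀[ℝ]^(p + q) (Module.Dual ℝ 𝔤) := by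
  rw [ExteriorAlgebra.exteriorPower, pow_add]
  exact Submodule.mul_mem_mul hα hβ

theorem contr_mem_pred {k : ℕ} {α : Form 𝔤} (hα : α ∈ ⋀[ℝ]^k (Module.Dual ℝ 𝔤)) (x : 𝔤) :
    contr x α ∈ ⋀[ℝ]^(k - 1) (Module.Dual ℝ 𝔤) := by
  induction hα using Submodule.pow_induction_on_left' with
  | algebraMap r => rw [contr_algebraMap]; exact Submodule.zero_mem _
  | add a b i ha hb h1 h2 => rw [map_add]; exact Submodule.add_mem _ h1 h2
  | mem_mul m hm i a ha h =>
    obtain ⟨η, rfl⟩ := hm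
    rw [contr_oneForm_mul, Nat.succ_eq_add_one, Nat.add_sub_cancel]
    exact Submodule.sub_mem _ (Submodule.smul_mem _ _ ha) (oneForm_mul_contr_mem ha η x)

theorem contr_mem {k : ℕ} {α : Form 𝔤} (hα : α ∈ ⋀[ℝ]^(k + 1) (Module.Dual ℝ 𝔤)) (x : 𝔤) :
    contr x α ∈ ⋀[ℝ]^k (Module.Dual ℝ 𝔤) :=
  contr_mem_pred hα x

theorem exists_algebraMap_of_mem_zero {α : Form 𝔤} (hα : α ∈ ⋀[ℝ]^0 (Module.Dual ℝ 𝔤)) :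
    ∃ r : ℝ, α = algebraMap ℝ (Form 𝔤) r := by
  rw [ExteriorAlgebra.exteriorPower, pow_zero] at hα
  obtain ⟨r, hr⟩ := Submodule.mem_one.mp hα
  exact ⟨r, hr.symm⟩

theorem exists_oneForm_of_mem_one {α : Form 𝔤} (hα : α ∈ ⋀[ℝ]^1 (Module.Dual ℝ 𝔤)) :
    ∃ θ : Module.Dual ℝ 𝔤, α = oneForm θ := by
  rw [ExteriorAlgebra.exteriorPower, pow_one] at hα
  obtain ⟨θ, hθ⟩ := hα
  exact ⟨θ, hθ.symm⟩

theorem oneForm_mul_self (θ : Module.Dual ℝ 𝔤) : oneForm θ * oneForm θ = 0 :=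
  ExteriorAlgebra.ι_sq_zero θ

theorem oneForm_mul_self_mul (θ : Module.Dual ℝ 𝔤) (α : Form 𝔤) :
    oneForm θ * (oneForm θ * α) = 0 := by
  rw [← mul_assoc, oneForm_mul_self, zero_mul]

theorem oneForm_mul_swap (θ η : Module.Dual ℝ 𝔤) (α : Form 𝔤) :
    oneForm θ * (oneForm η * α) = -(oneForm η * (oneForm θ * α)) := by
  rw [← mul_assoc, eq_neg_of_add_eq_zero_left (ExteriorAlgebra.ι_add_mul_swap θ η), neg_mul,
    mul_assoc]

theorem commute_oneForm_of_even {r : ℕ} {α : Form 𝔤} (hα : α ∈ ⋀[ℝ]^(2 * r) (Module.Dual ℝ 𝔤))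
    (θ : Module.Dual ℝ 𝔤) : oneForm θ * α = α * oneForm θ := by
  rw [oneForm_mul_comm hα]; simp

variable [FiniteDimensional ℝ 𝔤]

/-- Euler's formula `∑ eⁱ ∧ ι_{eᵢ} α = k α` for a `k`-form `α`. -/
theorem sum_coord_mul_contr {k : ℕ} {α : Form 𝔤} (hα : α ∈ ⋀[ℝ]^k (Module.Dual ℝ 𝔤)) :
    ∑ i, oneForm ((Module.finBasis ℝ 𝔤).coord i) * contr (Module.finBasis ℝ 𝔤 i) α =
      (k : ℝ) • α := by
  induction hα using Submodule.pow_induction_on_left' with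
  | algebraMap r => simp [contr_algebraMap]
  | add a b i ha hb h1 h2 =>
    simp only [map_add, mul_add, Finset.sum_add_distrib, h1, h2, smul_add]
  | mem_mul m hm i a ha h =>
    obtain ⟨η, rfl⟩ := hm
    simp only [contr_oneForm_mul, mul_sub, mul_smul_comm, Finset.sum_sub_distrib]
    have h1 : ∑ j, η (Module.finBasis ℝ 𝔤 j) • (oneForm ((Module.finBasis ℝ 𝔤).coord j) * a) =
        oneForm η * a := by
      rw [sum_coord_oneForm η, Finset.sum_mul]
      simp only [smul_mul_assoc]
    have h2 : ∀ j, oneForm ((Module.finBasis ℝ 𝔤).coord j) *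
        (oneForm η * contr (Module.finBasis ℝ 𝔤 j) a) = -(oneForm η *
        (oneForm ((Module.finBasis ℝ 𝔤).coord j) * contr (Module.finBasis ℝ 𝔤 j) a)) :=
      fun j => oneForm_mul_swap _ _ _
    simp only [h1, h2, Finset.sum_neg_distrib, ← Finset.mul_sum, h, mul_smul_comm]
    push_cast
    module

theorem eq_zero_of_contr_eq_zero {k : ℕ} {α : Form 𝔤}
    (hα : α ∈ ⋀[ℝ]^(k + 1) (Module.Dual ℝ 𝔤)) (h : ∀ x : 𝔤, contr x α = 0) : α = 0 := by
  have h1 := sum_coord_mul_contr hα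
  simp only [h, mul_zero, Finset.sum_const_zero] at h1
  exact (smul_eq_zero.mp h1.symm).resolve_left (by positivity)

/-- A nonzero form killed by all covectors has top degree. -/
theorem degree_eq_finrank_of_oneForm_mul_eq_zero {k : ℕ} {α : Form 𝔤}
    (hα : α ∈ ⋀[ℝ]^k (Module.Dual ℝ 𝔤)) (h : ∀ θ : Module.Dual ℝ 𝔤, oneForm θ * α = 0)
    (h0 : α ≠ 0) : k = Module.finrank ℝ 𝔤 := by
  have h1 := sum_coord_mul_contr hα
  have h2 : ∀ i, oneForm ((Module.finBasis ℝ 𝔤).coord i) * contr (Module.finBasis ℝ 𝔤 i) α =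
      α := by
    intro i
    -- Contracting `eⁱ ∧ α = 0` with `eᵢ` turns each term of Euler's sum into `α`; comparing `dim 𝔤
    -- • α` with `k • α` gives the degree.
    have := congrArg (contr (Module.finBasis ℝ 𝔤 i)) (h ((Module.finBasis ℝ 𝔤).coord i))
    rw [contr_oneForm_mul, map_zero, sub_eq_zero] at this
    rw [← this]; simp
  simp only [h2, Finset.sum_const, Finset.card_univ, Fintype.card_fin] at h1
  rw [← Nat.cast_smul_eq_nsmul ℝ] at h1
  exact_mod_cast (smul_left_injective ℝ h0 h1).symm

theorem eq_zero_of_finrank_lt {k : ℕ} {α : Form 𝔤}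
    (hα : α ∈ ⋀[ℝ]^k (Module.Dual ℝ 𝔤)) (h : Module.finrank ℝ 𝔤 < k) : α = 0 := by
  have h1 : Module.finrank ℝ (⋀[ℝ]^k (Module.Dual ℝ 𝔤)) = 0 := by
    rw [exteriorPower.finrank_eq, Subspace.dual_finrank_eq, Nat.choose_eq_zero_of_lt h]
  have h2 := Submodule.finrank_eq_zero.mp h1
  rw [h2] at hα
  simpa using hα

theorem finrank_exteriorPower_symm {p q : ℕ} (h : p + q = Module.finrank ℝ 𝔤) :
    Module.finrank ℝ (⋀[ℝ]^p (Module.Dual ℝ 𝔤)) =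
      Module.finrank ℝ (⋀[ℝ]^q (Module.Dual ℝ 𝔤)) := by
  rw [exteriorPower.finrank_eq, exteriorPower.finrank_eq, Subspace.dual_finrank_eq]
  exact Nat.choose_symm_of_eq_add h.symm

end Contraction

/-! ### Linear Lefschetz theory of a symplectic form -/

namespace SymplecticForm

variable {𝔤 : Type*} [LieRing 𝔤] [LieAlgebra ℝ 𝔤] [FiniteDimensional ℝ 𝔤] (ω : SymplecticForm 𝔤)

/-- The covector `ω(x, ·)`, linearly in `x`. -/
def flat : 𝔤 →ₗ[ℝ] Module.Dual ℝ 𝔤 :=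
  LinearMap.mk₂ ℝ (eval₂ ω.form)
    (fun x y z => by simp [eval₂, contr_add_left])
    (fun c x y => by simp [eval₂, contr_smul_left])
    (fun x y z => by simp [eval₂, contr_add_left])
    (fun c x y => by simp [eval₂, contr_smul_left])

theorem flat_apply (x y : 𝔤) : ω.flat x y = eval₂ ω.form x y := rfl

theorem contr_form (x : 𝔤) : contr x ω.form = oneForm (ω.flat x) := by
  obtain ⟨θ, hθ⟩ := exists_oneForm_of_mem_one (contr_mem ω.mem x)
  rw [hθ]
  congr 1
  ext y
  rw [flat_apply, eval₂, hθ, contr_oneForm]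
  simp [ExteriorAlgebra.algebraMapInv]

theorem flat_swap (x y : 𝔤) : ω.flat x y = -ω.flat y x := by
  rw [flat_apply, flat_apply, eval₂, eval₂, contr_comm, map_neg]

theorem flat_self (x : 𝔤) : ω.flat x x = 0 := by
  have := ω.flat_swap x x
  linarith

theorem flat_injective : Function.Injective ω.flat := by
  rw [← LinearMap.ker_eq_bot, LinearMap.ker_eq_bot']
  intro x hx
  exact ω.nondegenerate x fun y => by rw [← flat_apply, hx, LinearMap.zero_apply]

/-- The isomorphism `𝔤 ≃ 𝔤*` given by `ω`. -/
def flatEquiv : 𝔤 ≃ₗ[ℝ] Module.Dual ℝ 𝔤 :=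
  LinearEquiv.ofInjectiveOfFinrankEq ω.flat ω.flat_injective Subspace.dual_finrank_eq.symm

theorem flatEquiv_apply (x : 𝔤) : ω.flatEquiv x = ω.flat x := rfl

theorem exists_flat_eq (θ : Module.Dual ℝ 𝔤) : ∃ x, ω.flat x = θ :=
  ⟨ω.flatEquiv.symm θ, ω.flatEquiv.apply_symm_apply θ⟩

theorem contr_form_mul (x : 𝔤) (α : Form 𝔤) :
    contr x (ω.form * α) = oneForm (ω.flat x) * α + ω.form * contr x α := by
  rw [contr_mul ω.mem, contr_form]; simp

theorem oneForm_mul_pow_mul (θ : Module.Dual ℝ 𝔤) (r : ℕ) (α : Form 𝔤) :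
    oneForm θ * (ω.form ^ r * α) = ω.form ^ r * (oneForm θ * α) := by
  rw [← mul_assoc, commute_oneForm_of_even (ω.pow_mem r), mul_assoc]

theorem contr_pow_succ_mul (x : 𝔤) (r : ℕ) (α : Form 𝔤) :
    contr x (ω.form ^ (r + 1) * α) =
      ((r : ℝ) + 1) • (ω.form ^ r * (oneForm (ω.flat x) * α)) + ω.form ^ (r + 1) * contr x α := by
  induction r with
  | zero => simp [contr_form_mul]
  | succ r ih =>
    have h : ∀ s X, ω.form * (ω.form ^ s * X) = ω.form ^ (s + 1) * X := fun s X => by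
      rw [← mul_assoc, ← pow_succ']
    rw [← h, contr_form_mul, ih, oneForm_mul_pow_mul, mul_add, mul_smul_comm, h, h]
    push_cast
    module

theorem contr_pow_succ (x : 𝔤) (r : ℕ) :
    contr x (ω.form ^ (r + 1)) = ((r : ℝ) + 1) • (ω.form ^ r * oneForm (ω.flat x)) := by
  have h := ω.contr_pow_succ_mul x r 1
  have h1 : contr x (1 : Form 𝔤) = 0 := by simpa using contr_algebraMap x 1
  simpa [h1] using h

/-- Take the last nonzero power `ωⁿ`. Contracting `ωⁿ⁺¹ = 0` with `x` gives `ωⁿ ∧ ω(x, ·) = 0`; by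
non-degeneracy every covector kills `ωⁿ`, which therefore has top degree. -/
theorem exists_finrank_eq_and_pow_ne_zero :
    ∃ n, Module.finrank ℝ 𝔤 = 2 * n ∧ ω.form ^ n ≠ 0 := by
  classical
  have hex : ∃ r, ω.form ^ r = 0 :=
    ⟨Module.finrank ℝ 𝔤 + 1, eq_zero_of_finrank_lt (ω.pow_mem _) (by omega)⟩
  have h0 := Nat.find_spec hex
  have hmin : ∀ m, m < Nat.find hex → ω.form ^ m ≠ 0 := fun m hm => Nat.find_min hex hm
  cases hr : Nat.find hex with
  | zero =>
    rw [hr, pow_zero] at h0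
    exact absurd h0 one_ne_zero
  | succ n =>
    rw [hr] at h0 hmin
    refine ⟨n, (degree_eq_finrank_of_oneForm_mul_eq_zero (ω.pow_mem n) (fun θ => ?_)
      (hmin n n.lt_succ_self)).symm, hmin n n.lt_succ_self⟩
    obtain ⟨x, rfl⟩ := ω.exists_flat_eq θ
    have h := ω.contr_pow_succ x n
    rw [h0, map_zero] at h
    rw [commute_oneForm_of_even (ω.pow_mem n)]
    exact (smul_eq_zero.mp h.symm).resolve_left (by positivity)

theorem pow_ne_zero {n : ℕ} (hn : Module.finrank ℝ 𝔤 = 2 * n) {r : ℕ} (hr : r ≤ n) :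
    ω.form ^ r ≠ 0 := by
  obtain ⟨m, hm, h⟩ := ω.exists_finrank_eq_and_pow_ne_zero
  obtain rfl : m = n := by omega
  obtain ⟨s, rfl⟩ := Nat.exists_eq_add_of_le hr
  rw [pow_add] at h
  exact left_ne_zero_of_mul h

/-- Contracting `ωʳ⁺¹ ∧ α = 0` with `x` gives a term containing `ωʳ ∧ α = 0` and the term `ωʳ⁺¹ ∧
ι_x α`. So the induction trades one degree of `α` for one more power of `ω`, keeping `k + r` fixed.
-/
theorem eq_zero_of_pow_mul_eq_zero {n : ℕ} (hn : Module.finrank ℝ 𝔤 = 2 * n) {k r : ℕ}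
    (hkr : k + r ≤ n) {α : Form 𝔤} (hα : α ∈ ⋀[ℝ]^k (Module.Dual ℝ 𝔤))
    (h : ω.form ^ r * α = 0) : α = 0 := by
  induction k generalizing r α with
  | zero =>
    obtain ⟨c, rfl⟩ := exists_algebraMap_of_mem_zero hα
    rw [Algebra.algebraMap_eq_smul_one, mul_smul_comm, mul_one] at h
    rw [(smul_eq_zero.mp h).resolve_right (ω.pow_ne_zero hn (by omega)), map_zero]
  | succ k ih =>
    refine eq_zero_of_contr_eq_zero hα fun x => ?_
    refine ih (r := r + 1) (by omega) (contr_mem hα x) ?_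
    have h1 := ω.contr_pow_succ_mul x r α
    rw [pow_succ', mul_assoc, h, mul_zero, map_zero, ← oneForm_mul_pow_mul, h, mul_zero,
      smul_zero, zero_add] at h1
    rw [pow_succ']
    exact h1.symm

/-- The Lefschetz isomorphism `⋀ᵖ 𝔤* ≅ ⋀ᵖ⁺²ʳ 𝔤*` on forms. -/
theorem exists_pow_mul_eq {p r : ℕ} (h : 2 * (p + r) = Module.finrank ℝ 𝔤) {β : Form 𝔤}
    (hβ : β ∈ ⋀[ℝ]^(p + 2 * r) (Module.Dual ℝ 𝔤)) :
    ∃ α ∈ ⋀[ℝ]^p (Module.Dual ℝ 𝔤), ω.form ^ r * α = β := by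
  let L : ⋀[ℝ]^p (Module.Dual ℝ 𝔤) →ₗ[ℝ] ⋀[ℝ]^(p + 2 * r) (Module.Dual ℝ 𝔤) :=
    (LinearMap.mulLeft ℝ (ω.form ^ r)).restrict fun α hα => ω.pow_mul_mem r hα
  have hinj : Function.Injective L := by
    rw [← LinearMap.ker_eq_bot, LinearMap.ker_eq_bot']
    intro α hα
    exact Subtype.ext (ω.eq_zero_of_pow_mul_eq_zero h.symm le_rfl α.2 (congrArg Subtype.val hα))
  have hsurj := (LinearMap.injective_iff_surjective_of_finrank_eq_finrank
    (finrank_exteriorPower_symm (by omega))).mp hinj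
  obtain ⟨α, hα⟩ := hsurj ⟨β, hβ⟩
  exact ⟨α, α.2, congrArg Subtype.val hα⟩

theorem exists_smul_pow_eq {n : ℕ} (hn : Module.finrank ℝ 𝔤 = 2 * n) {β : Form 𝔤}
    (hβ : β ∈ ⋀[ℝ]^(2 * n) (Module.Dual ℝ 𝔤)) : ∃ c : ℝ, β = c • ω.form ^ n := by
  obtain ⟨α, hα, rfl⟩ := ω.exists_pow_mul_eq (p := 0) (r := n) (by omega) (by simpa using hβ)
  obtain ⟨c, rfl⟩ := exists_algebraMap_of_mem_zero hα
  exact ⟨c, by rw [Algebra.algebraMap_eq_smul_one, mul_smul_comm, mul_one]⟩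

end SymplecticForm

/-! ### Lie derivative and the differential of a semidirect product -/

section LieDerivative

variable {𝔤 : Type*} [LieRing 𝔤] [LieAlgebra ℝ 𝔤]

theorem form_induction {P : Form 𝔤 → Prop} (algebraMap : ∀ r, P (algebraMap ℝ (Form 𝔤) r))
    (add : ∀ α β, P α → P β → P (α + β)) (mul : ∀ θ α, P α → P (oneForm θ * α)) (α : Form 𝔤) :
    P α :=
  CliffordAlgebra.left_induction 0 algebraMap add (fun α θ h => mul θ α h) α

variable [FiniteDimensional ℝ 𝔤]

theorem d_oneForm_mul (θ : Module.Dual ℝ 𝔤) (β : Form 𝔤) :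
    d (oneForm θ * β) = d (oneForm θ) * β - oneForm θ * d β := by
  rw [d_mul (oneForm_mem θ), pow_one, neg_one_smul, sub_eq_add_neg]

/-- The Lie derivative along `f`, defined by Cartan's formula. -/
def lieDer (f : 𝔤) : Form 𝔤 →ₗ[ℝ] Form 𝔤 :=
  d ∘ₗ contr f + contr f ∘ₗ d

theorem lieDer_apply (f : 𝔤) (α : Form 𝔤) : lieDer f α = d (contr f α) + contr f (d α) := rfl

theorem lieDer_algebraMap (f : 𝔤) (r : ℝ) : lieDer f (algebraMap ℝ (Form 𝔤) r) = 0 := by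
  rw [lieDer_apply, contr_algebraMap, d_algebraMap, map_zero, map_zero, add_zero]

theorem lieDer_oneForm (f : 𝔤) (θ : Module.Dual ℝ 𝔤) :
    lieDer f (oneForm θ) = -oneForm (θ ∘ₗ (LieAlgebra.ad ℝ 𝔤 f : 𝔤 →ₗ[ℝ] 𝔤)) := by
  rw [lieDer_apply, contr_oneForm, d_algebraMap, zero_add, contr_d_oneForm]

theorem lieDer_oneForm_mul (f : 𝔤) (θ : Module.Dual ℝ 𝔤) (β : Form 𝔤) :
    lieDer f (oneForm θ * β) = lieDer f (oneForm θ) * β + oneForm θ * lieDer f β := by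
  have h1 := contr_mul (d_mem (oneForm_mem θ)) f β
  simp only [lieDer_apply, contr_oneForm_mul, d_oneForm_mul, map_sub, map_smul, h1, contr_oneForm,
    d_algebraMap, zero_add, mul_add]
  norm_num
  abel

theorem lieDer_mul (f : 𝔤) (α β : Form 𝔤) :
    lieDer f (α * β) = lieDer f α * β + α * lieDer f β := by
  induction α using form_induction with
  | algebraMap r => rw [lieDer_algebraMap, Algebra.algebraMap_eq_smul_one]; simp
  | add a b ha hb => rw [add_mul, map_add, ha, hb, map_add, add_mul, add_mul]; abel
  | mul θ a h =>
    rw [mul_assoc, lieDer_oneForm_mul, h, lieDer_oneForm_mul, mul_add, add_mul]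
    simp only [mul_assoc]
    abel

theorem lieDer_mem (f : 𝔤) {k : ℕ} {α : Form 𝔤} (hα : α ∈ ⋀[ℝ]^k (Module.Dual ℝ 𝔤)) :
    lieDer f α ∈ ⋀[ℝ]^k (Module.Dual ℝ 𝔤) := by
  cases k with
  | zero =>
    obtain ⟨r, rfl⟩ := exists_algebraMap_of_mem_zero hα
    rw [lieDer_algebraMap]; exact Submodule.zero_mem _
  | succ k => exact Submodule.add_mem _ (d_mem (contr_mem hα f)) (contr_mem (d_mem hα) f)

theorem lieDer_contr (f x : 𝔤) (α : Form 𝔤) :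
    lieDer f (contr x α) = contr x (lieDer f α) + contr ⁅f, x⁆ α := by
  induction α using form_induction with
  | algebraMap r => simp only [contr_algebraMap, lieDer_algebraMap, map_zero, add_zero]
  | add a b ha hb => simp only [map_add, ha, hb]; abel
  | mul θ a h =>
    simp only [contr_oneForm_mul, lieDer_mul, map_sub, map_add, map_smul, h, lieDer_oneForm,
      neg_mul, map_neg, contr_oneForm_mul, LinearMap.comp_apply, LieAlgebra.ad_apply, mul_add]
    module

theorem lieDer_contr_self (f : 𝔤) (α : Form 𝔤) :
    lieDer f (contr f α) = contr f (lieDer f α) := by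
  rw [lieDer_contr, lie_self]; simp [contr]

/-- `(τ, f)` exhibits `𝔤` as the semidirect product of `ℝ f` and the abelian ideal `ker τ`. -/
structure IsSplitting (τ : Module.Dual ℝ 𝔤) (f : 𝔤) : Prop where
  apply_self : τ f = 1
  apply_lie : ∀ x, τ ⁅f, x⁆ = 0
  lie_eq : ∀ x y, ⁅x, y⁆ = τ x • ⁅f, y⁆ - τ y • ⁅f, x⁆

namespace IsSplitting

variable {τ : Module.Dual ℝ 𝔤} {f : 𝔤} (h : IsSplitting τ f)
include h

theorem lieDer_covector : lieDer f (oneForm τ) = 0 := by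
  have : τ ∘ₗ (LieAlgebra.ad ℝ 𝔤 f : 𝔤 →ₗ[ℝ] 𝔤) = 0 := by
    ext x; exact h.apply_lie x
  rw [lieDer_oneForm, this]; simp

theorem lieDer_covector_mul (α : Form 𝔤) :
    lieDer f (oneForm τ * α) = oneForm τ * lieDer f α := by
  rw [lieDer_mul, h.lieDer_covector, zero_mul, zero_add]

theorem d_oneForm_eq (θ : Module.Dual ℝ 𝔤) :
    d (oneForm θ) = oneForm τ * lieDer f (oneForm θ) := by
  rw [← sub_eq_zero]
  refine eq_zero_of_contr_eq_zero (k := 1) (Submodule.sub_mem _ (d_mem (oneForm_mem θ))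
    (oneForm_mul_mem (lieDer_mem f (oneForm_mem θ)) τ)) fun x => ?_
  have hx : θ ∘ₗ (LieAlgebra.ad ℝ 𝔤 x : 𝔤 →ₗ[ℝ] 𝔤) =
      τ x • θ ∘ₗ (LieAlgebra.ad ℝ 𝔤 f : 𝔤 →ₗ[ℝ] 𝔤) - θ ⁅f, x⁆ • τ := by
    ext y
    simp [h.lie_eq x y, mul_comm]
  rw [map_sub, contr_oneForm_mul, lieDer_oneForm, map_neg, contr_oneForm, contr_d_oneForm, hx,
    LinearMap.comp_apply, LieAlgebra.ad_apply, Algebra.algebraMap_eq_smul_one, oneForm, oneForm,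
    map_sub, map_smul, map_smul, mul_neg, mul_smul_comm, mul_one]
  module

/-- Both sides are antiderivations that agree on covectors. In particular `L_f`-invariant forms are
closed. -/
theorem d_eq (α : Form 𝔤) : d α = oneForm τ * lieDer f α := by
  induction α using form_induction with
  | algebraMap r => rw [d_algebraMap, lieDer_algebraMap, mul_zero]
  | add a b ha hb => rw [map_add, ha, hb, map_add, mul_add]
  | mul θ a ih =>
    rw [d_oneForm_mul, lieDer_mul, h.d_oneForm_eq, ih, mul_add, oneForm_mul_swap τ θ, mul_assoc,
      sub_eq_add_neg]

end IsSplitting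

end LieDerivative

/-! ### The symplectic form on a split algebra, and unimodularity -/

namespace SymplecticForm

variable {𝔤 : Type*} [LieRing 𝔤] [LieAlgebra ℝ 𝔤] [FiniteDimensional ℝ 𝔤] (ω : SymplecticForm 𝔤)

theorem d_pow (r : ℕ) : d (ω.form ^ r) = 0 := by
  have h := ω.d_pow_mul r 1
  have h1 : d (1 : Form 𝔤) = 0 := by simpa using d_algebraMap (𝔤 := 𝔤) 1
  simpa [h1] using h

theorem lieDer_form (f : 𝔤) : lieDer f ω.form = d (oneForm (ω.flat f)) := by
  rw [lieDer_apply, ω.closed, map_zero, add_zero, contr_form]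

/-- The cocycle identity `ω([f, x], y) + ω(x, [f, y]) = ω(f, [x, y])`. -/
theorem flat_lie_add (f x y : 𝔤) :
    ω.flat ⁅f, x⁆ y + ω.flat x ⁅f, y⁆ = ω.flat f ⁅x, y⁆ := by
  have h := lieDer_contr f x ω.form
  rw [contr_form, contr_form, lieDer_form, contr_d_oneForm, lieDer_oneForm] at h
  have h1 := congrArg (contr y) h
  simp only [map_neg, map_add, contr_oneForm, LinearMap.comp_apply, LieAlgebra.ad_apply] at h1
  rw [← map_neg (algebraMap ℝ (Form 𝔤)), ← map_neg (algebraMap ℝ (Form 𝔤)), ← map_add] at h1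
  have := FaithfulSMul.algebraMap_injective ℝ (Form 𝔤) h1
  linarith

theorem lieDer_pow_mul {f : 𝔤} (hf : lieDer f ω.form = 0) (r : ℕ) (α : Form 𝔤) :
    lieDer f (ω.form ^ r * α) = ω.form ^ r * lieDer f α := by
  induction r with
  | zero => simp
  | succ r ih => rw [pow_succ', mul_assoc, lieDer_mul, hf, ih, zero_mul, zero_add, mul_assoc]

/-- A criterion for `f` to act by infinitesimal symplectomorphisms. -/
theorem lieDer_form_eq_zero {f : 𝔤} (hf : ∀ x y : 𝔤, ω.flat f ⁅x, y⁆ = 0) :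
    lieDer f ω.form = 0 := by
  rw [lieDer_form]
  refine eq_zero_of_contr_eq_zero (d_mem (oneForm_mem _)) fun x => ?_
  rw [contr_d_oneForm]
  have : ω.flat f ∘ₗ (LieAlgebra.ad ℝ 𝔤 x : 𝔤 →ₗ[ℝ] 𝔤) = 0 := by
    ext y; exact hf x y
  rw [this]; simp

section Splitting

variable {τ : Module.Dual ℝ 𝔤} {f v : 𝔤}

/-- By the cocycle identity, `ad f` plus its `ω`-transpose is an operator of rank at most two. The
transpose has the same trace, and each rank-one term contributes `-ω(f, [f, v])`, so the factor 2
cancels. -/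
theorem trace_ad (h : IsSplitting τ f) (hv : ω.flat v = τ) :
    LinearMap.trace ℝ 𝔤 (LieAlgebra.ad ℝ 𝔤 f) = -ω.flat f ⁅f, v⁆ := by
  set B : 𝔤 →ₗ[ℝ] 𝔤 := LieAlgebra.ad ℝ 𝔤 f with hB
  obtain ⟨p, hp⟩ := ω.exists_flat_eq (ω.flat f ∘ₗ B)
  have key : B + ω.flatEquiv.symm.conj (Module.Dual.transpose B) =
      τ.smulRight p - (ω.flat f ∘ₗ B).smulRight v := by
    ext x
    apply ω.flatEquiv.injective
    ext y
    simp only [LinearMap.add_apply, map_add, LinearEquiv.conj_apply, LinearMap.comp_apply,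
      LinearEquiv.coe_coe, LinearEquiv.symm_symm, LinearEquiv.apply_symm_apply,
      LinearMap.sub_apply, map_sub, LinearMap.smulRight_apply, map_smul, flatEquiv_apply, hp, hv,
      Module.Dual.transpose_apply, LinearMap.smul_apply, hB, LieAlgebra.ad_apply, smul_eq_mul]
    rw [flat_lie_add, h.lie_eq x y]
    simp [mul_comm]
  have ht := congrArg (LinearMap.trace ℝ 𝔤) key
  rw [map_add, map_sub, LinearMap.trace_conj', LinearMap.trace_transpose',
    LinearMap.trace_smulRight, LinearMap.trace_smulRight, ← hv, flat_swap, hp,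
    LinearMap.comp_apply, hB, LieAlgebra.ad_apply] at ht
  linarith

theorem apply_dual_vector (hv : ω.flat v = τ) : τ v = 0 := by rw [← hv, flat_self]

/-- The direction `v` dual to `τ` is central when `𝔤` is unimodular. -/
theorem lie_dual_vector (h : IsSplitting τ f) (hv : ω.flat v = τ)
    (ht : LinearMap.trace ℝ 𝔤 (LieAlgebra.ad ℝ 𝔤 f) = 0) : ⁅f, v⁆ = 0 := by
  rw [ω.trace_ad h hv, neg_eq_zero] at ht
  have hτv := ω.apply_dual_vector hv
  have h1 : ω.flat ⁅f, v⁆ = ω.flat ⁅f, v⁆ f • τ := by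
    ext y
    -- `y - τ y • f` is the component of `y` in `ker τ`; it commutes with `v`, which also lies in
    -- `ker τ`. So `ω([f, v], ·)` vanishes on `ker τ`, and its remaining coefficient is the trace.
    have h2 := ω.flat_lie_add f v (y - τ y • f)
    have h3 : τ (y - τ y • f) = 0 := by simp [h.apply_self]
    rw [hv, h.apply_lie, h.lie_eq v, hτv, h3, zero_smul, zero_smul, sub_zero, map_zero,
      add_zero, map_sub, map_smul, smul_eq_mul, sub_eq_zero] at h2
    rw [h2, LinearMap.smul_apply, smul_eq_mul, mul_comm]
  rw [flat_swap, ht, neg_zero, zero_smul] at h1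
  exact ω.flat_injective (by rw [h1, map_zero])

end Splitting

end SymplecticForm

/-- The endomorphism `B` has no Jordan block of size at least two with eigenvalue in the base
field. -/
def HasTrivialJordanBlocks {V : Type*} [AddCommGroup V] [Module ℝ V] (B : V →ₗ[ℝ] V) : Prop :=
  ∀ (μ : ℝ) (x y : V), B x = μ • x + y → B y = μ • y → y = 0

/-! ### Hard Lefschetz forces trivial Jordan blocks -/

namespace SymplecticForm

variable {𝔤 : Type*} [LieRing 𝔤] [LieAlgebra ℝ 𝔤] [FiniteDimensional ℝ 𝔤] (ω : SymplecticForm 𝔤)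

theorem lefschetz_injective_iff (r p : ℕ) : Function.Injective (ω.lefschetz r p) ↔
    ∀ α ∈ closedForms 𝔤 p, ω.form ^ r * α ∈ exactForms 𝔤 (p + 2 * r) → α ∈ exactForms 𝔤 p := by
  rw [← LinearMap.ker_eq_bot, LinearMap.ker_eq_bot']
  constructor
  · intro H α hα h
    have h1 := H (Submodule.Quotient.mk ⟨α, hα⟩)
      ((Submodule.Quotient.mk_eq_zero _).mpr h)
    exact (Submodule.Quotient.mk_eq_zero ((exactForms 𝔤 p).submoduleOf (closedForms 𝔤 p))).mp h1
  · intro H a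
    obtain ⟨α, rfl⟩ := Submodule.Quotient.mk_surjective _ a
    intro h
    refine (Submodule.Quotient.mk_eq_zero _).mpr ?_
    exact H α α.2 ((Submodule.Quotient.mk_eq_zero
      ((exactForms 𝔤 (p + 2 * r)).submoduleOf (closedForms 𝔤 (p + 2 * r)))).mp h)

theorem lefschetz_surjective_of_exists {r p : ℕ} (H : ∀ β ∈ closedForms 𝔤 (p + 2 * r),
    ∃ α ∈ closedForms 𝔤 p, ω.form ^ r * α - β ∈ exactForms 𝔤 (p + 2 * r)) :
    Function.Surjective (ω.lefschetz r p) := by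
  intro b
  obtain ⟨β, rfl⟩ := Submodule.Quotient.mk_surjective _ b
  obtain ⟨α, hα, h⟩ := H β β.2
  exact ⟨Submodule.Quotient.mk ⟨α, hα⟩, (Submodule.Quotient.eq _).mpr h⟩

/-- Top-degree forms are multiples of `ωⁿ`, which inherits invariance from `ω`. -/
theorem lieDer_top {f : 𝔤} (hf : lieDer f ω.form = 0) {n : ℕ} (hn : Module.finrank ℝ 𝔤 = 2 * n)
    {β : Form 𝔤} (hβ : β ∈ ⋀[ℝ]^(2 * n) (Module.Dual ℝ 𝔤)) : lieDer f β = 0 := by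
  obtain ⟨c, rfl⟩ := ω.exists_smul_pow_eq hn hβ
  have h1 : lieDer f (1 : Form 𝔤) = 0 := by simpa using lieDer_algebraMap f 1
  have h := ω.lieDer_pow_mul hf n 1
  rw [h1, mul_one, mul_zero] at h
  rw [map_smul, h, smul_zero]

section Splitting

variable {τ : Module.Dual ℝ 𝔤} {f v : 𝔤}

theorem contr_dual_vector_pow_mul (hv : ω.flat v = τ) {r : ℕ} {α : Form 𝔤}
    (h : ω.form ^ (r + 1) * α = 0) (hα : contr v α = 0) :
    ω.form ^ r * (oneForm τ * α) = 0 := by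
  have h1 := ω.contr_pow_succ_mul v r α
  rw [h, hα, map_zero, mul_zero, add_zero, hv] at h1
  exact (smul_eq_zero.mp h1.symm).resolve_left (by positivity)

include ω in
theorem exists_finrank_eq_succ (h : IsSplitting τ f) :
    ∃ r, Module.finrank ℝ 𝔤 = 2 * (r + 1) := by
  obtain ⟨n, hn, -⟩ := ω.exists_finrank_eq_and_pow_ne_zero
  have hf : f ≠ 0 := by
    rintro rfl
    simpa using h.apply_self
  have := Module.finrank_pos_iff_exists_ne_zero (R := ℝ).mpr ⟨f, hf⟩
  exact ⟨n - 1, by omega⟩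

/-- Here `ω` itself need not be invariant. Cartan's formula reduces the claim to `ωʳ ∧ τ ∧ α = 0`
with `α = L_f (ω(f, ·))`. This follows by contracting `ωʳ⁺¹ ∧ α`, zero for degree reasons, with `v`;
the condition `[f, v] = 0` enters as `ι_v α = 0`. -/
theorem lieDer_pow_top_eq_zero (h : IsSplitting τ f) (hv : ω.flat v = τ) (hfv : ⁅f, v⁆ = 0)
    {r : ℕ} (hr : Module.finrank ℝ 𝔤 = 2 * (r + 1)) : lieDer f (ω.form ^ (r + 1)) = 0 := by
  rw [lieDer_apply, d_pow, map_zero, add_zero, contr_pow_succ, map_smul, d_pow_mul,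
    h.d_oneForm_eq, contr_dual_vector_pow_mul ω hv, smul_zero]
  · exact eq_zero_of_finrank_lt
      (mul_mem_exteriorPower (ω.pow_mem _) (lieDer_mem f (oneForm_mem _))) (by omega)
  · rw [lieDer_oneForm, map_neg, contr_oneForm, LinearMap.comp_apply, LieAlgebra.ad_apply, hfv,
      map_zero, map_zero, neg_zero]

/-- If `[f, w] = v`, then `L_f (ι_w ωʳ⁺¹) = ι_v ωʳ⁺¹ = (r + 1) ωʳ ∧ τ`. The form `ι_w ωʳ⁺¹` is
closed, so Cartan's formula makes `ωʳ ∧ τ` exact, while `τ` is closed, nonzero and of degree 1,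
hence not exact. -/
theorem lie_ne_dual_vector (H : ω.HardLefschetz) (h : IsSplitting τ f) (hv : ω.flat v = τ)
    (hfv : ⁅f, v⁆ = 0) (w : 𝔤) : ⁅f, w⁆ ≠ v := by
  intro hw
  obtain ⟨r, hr⟩ := ω.exists_finrank_eq_succ h
  have hτ : d (oneForm τ) = 0 := by rw [h.d_eq, h.lieDer_covector, mul_zero]
  have hX : lieDer f (contr w (ω.form ^ (r + 1))) =
      ((r : ℝ) + 1) • (ω.form ^ r * oneForm τ) := by
    rw [lieDer_contr, ω.lieDer_pow_top_eq_zero h hv hfv hr, map_zero, zero_add, hw,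
      contr_pow_succ, hv]
  have hdX : d (contr w (ω.form ^ (r + 1))) = 0 := by
    rw [h.d_eq, hX, mul_smul_comm, oneForm_mul_pow_mul, oneForm_mul_self, mul_zero, smul_zero]
  rw [lieDer_apply, hdX, map_zero, add_zero] at hX
  have hexact : ω.form ^ r * oneForm τ ∈ exactForms 𝔤 (1 + 2 * r) := by
    refine mem_exactForms.mpr (Or.inr ⟨2 * r, by omega,
      ((r : ℝ) + 1)⁻¹ • contr f (contr w (ω.form ^ (r + 1))), ?_, ?_⟩)
    · exact Submodule.smul_mem _ _ (contr_mem (contr_mem (ω.pow_mem (r + 1)) w) f)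
    · rw [map_smul, hX, smul_smul, inv_mul_cancel₀ (by positivity), one_smul]
  have hinj := (ω.lefschetz_injective_iff r 1).mp (H r 1 (by omega)).1 _
    ⟨oneForm_mem τ, hτ⟩ hexact
  have h0 : oneForm τ = 0 := by
    rcases mem_exactForms.mp hinj with h0 | ⟨j, hj, β, hβ, h0⟩
    · exact h0
    · obtain rfl : j = 0 := by omega
      obtain ⟨c, rfl⟩ := exists_algebraMap_of_mem_zero hβ
      rw [← h0, d_algebraMap]
  have h1 := contr_oneForm f τ
  rw [h0, map_zero, h.apply_self, map_one] at h1
  exact zero_ne_one h1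

/-- If `v` is not of the form `[f, w]`, then `f` can be moved within `f + ker τ` so that `ω(f, ·)`
vanishes on the derived algebra. -/
theorem exists_adapted_splitting (h : IsSplitting τ f) (hv : ω.flat v = τ)
    (hw : ∀ w, ⁅f, w⁆ ≠ v) :
    ∃ f', IsSplitting τ f' ∧ (∀ x y : 𝔤, ω.flat f' ⁅x, y⁆ = 0) ∧
      ∀ x, τ x = 0 → ⁅f', x⁆ = ⁅f, x⁆ := by
  have hmem : v ∉ LinearMap.range (LieAlgebra.ad ℝ 𝔤 f : 𝔤 →ₗ[ℝ] 𝔤) := by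
    rintro ⟨w, h1⟩
    exact hw w h1
  obtain ⟨φ, hφv, hφ⟩ := Submodule.exists_le_ker_of_notMem hmem
  -- The scale and sign are chosen so that `τ f' = ω(v, f') = -ω(f', v) = 1`. Since `φ` vanishes on
  -- the image of `ad f`, which contains every bracket, so does `ω(f', ·)`.
  obtain ⟨f', hf'⟩ := ω.exists_flat_eq (-(φ v)⁻¹ • φ)
  have hφB : ∀ x, φ ⁅f, x⁆ = 0 := fun x => hφ (LinearMap.mem_range_self _ x)
  have hτf' : τ f' = 1 := by
    rw [← hv, flat_swap, hf']
    simp [hφv]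
  have hlie : ∀ x, ⁅f', x⁆ = ⁅f, x⁆ - τ x • ⁅f, f'⁆ := fun x => by
    rw [h.lie_eq f' x, hτf', one_smul]
  refine ⟨f', ⟨hτf', fun x => ?_, fun x y => ?_⟩, fun x y => ?_, fun x hx => ?_⟩
  · rw [hlie, map_sub, map_smul, h.apply_lie, h.apply_lie, smul_zero, sub_zero]
  · rw [hlie, hlie, h.lie_eq x y]
    module
  · rw [hf', h.lie_eq x y]
    simp [hφB]
  · rw [hlie, hx, zero_smul, sub_zero]

/-- Contracting `ωʳ⁺¹ ∧ α = 0` with `v` shows that `ωʳ ∧ γ` is closed, so `ωʳ ∧ α = L_f (ωʳ ∧ γ)` is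
exact by Cartan's formula. Lefschetz injectivity makes `α` exact, hence a multiple of `τ`, and `ι_f
α = 0` then leaves only zero. -/
theorem eq_zero_of_lieDer_eq (H : ω.HardLefschetz) (h : IsSplitting τ f) (hv : ω.flat v = τ)
    (hf : lieDer f ω.form = 0) {q r : ℕ} (hqr : 2 * (q + 1 + r) = Module.finrank ℝ 𝔤)
    {α γ : Form 𝔤} (hα : α ∈ ⋀[ℝ]^(q + 1) (Module.Dual ℝ 𝔤))
    (hγ : γ ∈ ⋀[ℝ]^(q + 1) (Module.Dual ℝ 𝔤)) (hγα : lieDer f γ = α) (hα0 : lieDer f α = 0)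
    (hfα : contr f α = 0) (hvα : contr v α = 0) (htop : ω.form ^ (r + 1) * α = 0) : α = 0 := by
  have hδ : lieDer f (ω.form ^ r * γ) = ω.form ^ r * α := by rw [ω.lieDer_pow_mul hf, hγα]
  have hdδ : d (ω.form ^ r * γ) = 0 := by
    rw [h.d_eq, hδ, oneForm_mul_pow_mul, ω.contr_dual_vector_pow_mul hv htop hvα]
  have hdα : d α = 0 := by rw [h.d_eq, hα0, mul_zero]
  rw [lieDer_apply, hdδ, map_zero, add_zero] at hδ
  have hexact : ω.form ^ r * α ∈ exactForms 𝔤 (q + 1 + 2 * r) := by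
    refine mem_exactForms.mpr (Or.inr ⟨q + 2 * r, by omega, _, ?_, hδ⟩)
    refine contr_mem ?_ f
    have := ω.pow_mul_mem r hγ
    rwa [show q + 1 + 2 * r = q + 2 * r + 1 by omega] at this
  have hinj := (ω.lefschetz_injective_iff r (q + 1)).mp (H r (q + 1) hqr).1 α ⟨hα, hdα⟩ hexact
  rcases mem_exactForms.mp hinj with h0 | ⟨j, hj, β, hβ, h0⟩
  · exact h0
  · have h1 : oneForm τ * α = 0 := by rw [← h0, h.d_eq, oneForm_mul_self_mul]
    have h2 := contr_oneForm_mul f τ α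
    rw [h1, map_zero, h.apply_self, hfα, mul_zero, sub_zero, one_smul] at h2
    exact h2.symm

theorem lieDer_flat (hf : ∀ x y : 𝔤, ω.flat f ⁅x, y⁆ = 0) (x : 𝔤) :
    lieDer f (oneForm (ω.flat x)) = oneForm (ω.flat ⁅f, x⁆) := by
  rw [lieDer_oneForm, ← map_neg]
  congr 1
  ext y
  have := ω.flat_lie_add f x y
  rw [hf] at this
  simp only [LinearMap.neg_apply, LinearMap.comp_apply, LieAlgebra.ad_apply]
  linarith

theorem contr_flat_lie (h : IsSplitting τ f) (hv : ω.flat v = τ)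
    (hf : ∀ x y : 𝔤, ω.flat f ⁅x, y⁆ = 0) (x : 𝔤) :
    ω.flat ⁅f, x⁆ f = 0 ∧ ω.flat ⁅f, x⁆ v = 0 := by
  rw [flat_swap, hf, flat_swap, hv, h.apply_lie, neg_zero]
  exact ⟨rfl, rfl⟩

/-- As `ad f` is skew for `ω`, the image of `ad f + μ` is `ω`-orthogonal to `y`. The operator is
thus not surjective, hence not injective. -/
theorem exists_lie_eq_neg_smul (hf : ∀ x y : 𝔤, ω.flat f ⁅x, y⁆ = 0) {μ : ℝ} {y : 𝔤}
    (hy : ⁅f, y⁆ = μ • y) (hy0 : y ≠ 0) : ∃ z : 𝔤, z ≠ 0 ∧ ⁅f, z⁆ = -μ • z := by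
  let C : 𝔤 →ₗ[ℝ] 𝔤 := (LieAlgebra.ad ℝ 𝔤 f : 𝔤 →ₗ[ℝ] 𝔤) + μ • LinearMap.id
  have hC : ∀ x, ω.flat y (C x) = 0 := fun x => by
    have h1 := ω.flat_lie_add f y x
    rw [hf, hy, map_smul, LinearMap.smul_apply, smul_eq_mul] at h1
    simp only [C, LinearMap.add_apply, LieAlgebra.ad_apply, LinearMap.smul_apply,
      LinearMap.id_apply, map_add, map_smul, smul_eq_mul]
    linarith
  have hninj : ¬ Function.Injective C := by
    rw [LinearMap.injective_iff_surjective]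
    intro hs
    refine hy0 (ω.flat_injective ?_)
    rw [map_zero]
    ext u
    obtain ⟨x, rfl⟩ := hs u
    exact hC x
  rw [← LinearMap.ker_eq_bot, ← ne_eq, Submodule.ne_bot_iff] at hninj
  obtain ⟨z, hz, hz0⟩ := hninj
  refine ⟨z, hz0, ?_⟩
  rw [neg_smul]
  exact eq_neg_of_add_eq_zero_left hz

theorem eq_zero_of_flat_mul_flat_eq_zero {μ : ℝ} (hμ : μ ≠ 0) {y z : 𝔤} (hy : ⁅f, y⁆ = μ • y)
    (hz : ⁅f, z⁆ = -μ • z) (hz0 : z ≠ 0)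
    (hyz : oneForm (ω.flat y) * oneForm (ω.flat z) = 0) : y = 0 := by
  have h1 : ∀ u, ω.flat y u • z = ω.flat z u • y := fun u => by
    have h2 := congrArg (contr u) hyz
    rw [contr_oneForm_mul, contr_oneForm, map_zero, Algebra.algebraMap_eq_smul_one, mul_smul_comm,
      mul_one, sub_eq_zero, oneForm, oneForm,
      ← map_smul (ExteriorAlgebra.ι ℝ), ← map_smul (ExteriorAlgebra.ι ℝ)] at h2
    have h3 := ExteriorAlgebra.ι_leftInverse.injective h2
    rw [← map_smul, ← map_smul] at h3
    exact ω.flat_injective h3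
  obtain ⟨u, hu⟩ : ∃ u, ω.flat z u ≠ 0 := by
    by_contra! hc
    exact hz0 (ω.nondegenerate z hc)
  -- `y` and `z` are dependent; applying `ad f` to the relation contradicts `μ ≠ -μ` unless `y = 0`.
  have h4 := congrArg (fun t => ⁅f, t⁆) (h1 u)
  simp only [lie_smul, hy, hz] at h4
  rw [smul_comm, h1, smul_comm, smul_smul, smul_smul, ← sub_eq_zero, ← sub_smul] at h4
  refine (smul_eq_zero.mp h4).resolve_left ?_
  rw [← mul_sub, show -μ - μ = -(2 * μ) by ring]
  exact mul_ne_zero hu (neg_ne_zero.mpr (mul_ne_zero two_ne_zero hμ))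

theorem hasTrivialJordanBlocks_of_hardLefschetz (H : ω.HardLefschetz) (h : IsSplitting τ f)
    (hv : ω.flat v = τ) (hf : ∀ x y : 𝔤, ω.flat f ⁅x, y⁆ = 0) :
    HasTrivialJordanBlocks (LieAlgebra.ad ℝ 𝔤 f : 𝔤 →ₗ[ℝ] 𝔤) := by
  intro μ x y hx hy
  rw [LieAlgebra.ad_apply] at hx hy
  have hT := ω.lieDer_form_eq_zero hf
  obtain ⟨n, hn⟩ := ω.exists_finrank_eq_succ h
  by_cases hμ : μ = 0
  · subst hμ
    rw [zero_smul, zero_add] at hx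
    rw [zero_smul] at hy
    have hy' := ω.contr_flat_lie h hv hf x
    rw [hx] at hy'
    have h0 : oneForm (ω.flat y) = 0 := by
      refine ω.eq_zero_of_lieDer_eq H h hv hT (q := 0) (r := n) (by omega) (oneForm_mem _)
        (oneForm_mem (ω.flat x)) ?_ ?_ ?_ ?_ ?_
      · rw [ω.lieDer_flat hf, hx]
      · rw [ω.lieDer_flat hf, hy, map_zero]
        exact map_zero (ExteriorAlgebra.ι ℝ)
      · rw [contr_oneForm, hy'.1, map_zero]
      · rw [contr_oneForm, hy'.2, map_zero]
      · exact eq_zero_of_finrank_lt (mul_mem_exteriorPower (ω.pow_mem _) (oneForm_mem _))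
          (by omega)
    rw [← map_zero (ExteriorAlgebra.ι ℝ)] at h0
    exact ω.flat_injective (by rw [ExteriorAlgebra.ι_leftInverse.injective h0, map_zero])
  -- The covector of `y` is not invariant when `μ ≠ 0`. Pairing with an eigenvector `z` for `-μ`
  -- cancels the weights: `ω(y, ·) ∧ ω(z, ·)` is invariant and is the Lie derivative of `ω(x, ·) ∧
  -- ω(z, ·)`.
  · by_contra hy0
    obtain ⟨z, hz0, hz⟩ := ω.exists_lie_eq_neg_smul hf hy hy0
    refine hy0 (ω.eq_zero_of_flat_mul_flat_eq_zero hμ hy hz hz0 ?_)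
    have hyd := ω.contr_flat_lie h hv hf y
    have hzd := ω.contr_flat_lie h hv hf z
    simp only [hy, hz, map_smul, LinearMap.smul_apply, smul_eq_zero, hμ, neg_eq_zero,
      false_or] at hyd hzd
    have hγ := oneForm_mul_mem (oneForm_mem (ω.flat z)) (ω.flat x)
    have hα := oneForm_mul_mem (oneForm_mem (ω.flat z)) (ω.flat y)
    have hγα : lieDer f (oneForm (ω.flat x) * oneForm (ω.flat z)) =
        oneForm (ω.flat y) * oneForm (ω.flat z) := by
      rw [lieDer_mul, ω.lieDer_flat hf, ω.lieDer_flat hf, hx, hz]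
      simp only [map_add, map_smul, add_mul, smul_mul_assoc, mul_smul_comm]
      module
    have hα0 : lieDer f (oneForm (ω.flat y) * oneForm (ω.flat z)) = 0 := by
      rw [lieDer_mul, ω.lieDer_flat hf, ω.lieDer_flat hf, hy, hz]
      simp only [map_smul, smul_mul_assoc, mul_smul_comm]
      module
    -- The dimension is `2(n + 1)`. For `n = 0` the 2-forms already have top degree, so the Lie
    -- derivative vanishes without using Lefschetz.
    cases n with
    | zero =>
      rw [← hγα]
      exact ω.lieDer_top hT hn hγ
    | succ r =>
      refine ω.eq_zero_of_lieDer_eq H h hv hT (q := 1) (r := r) (by omega) hα hγ hγα hα0 ?_ ?_ ?_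
      · rw [contr_oneForm_mul, contr_oneForm, hyd.1, hzd.1]; simp
      · rw [contr_oneForm_mul, contr_oneForm, hyd.2, hzd.2]; simp
      · rw [← hγα, ← ω.lieDer_pow_mul hT]
        exact ω.lieDer_top hT hn (mul_mem_exteriorPower (ω.pow_mem (r + 1)) hγ)

end Splitting

end SymplecticForm

/-! ### Jordan blocks, diagonalizability and semisimplicity -/

section Diagonalizable

open Polynomial

variable {V : Type*} [AddCommGroup V] [Module ℝ V]

/-- `B - μ` is invertible on every eigenspace with `ν ≠ μ`, so modulo the image of `B - μ` only the
`μ`-component survives. -/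
theorem exists_sub_mem_eigenspace {B : Module.End ℝ V} (μ : ℝ) {y : V}
    (hy : y ∈ ⨆ ν, B.eigenspace ν) :
    ∃ z ∈ ⨆ ν, B.eigenspace ν, y - (B z - μ • z) ∈ B.eigenspace μ := by
  induction hy using Submodule.iSup_induction' with
  | mem ν y hy =>
    have hy' := Module.End.mem_eigenspace_iff.mp hy
    by_cases hν : ν = μ
    · subst hν
      exact ⟨0, Submodule.zero_mem _, by simpa using hy⟩
    · refine ⟨(ν - μ)⁻¹ • y, Submodule.smul_mem _ _ (Submodule.mem_iSup_of_mem ν hy), ?_⟩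
      have : y - (B ((ν - μ)⁻¹ • y) - μ • (ν - μ)⁻¹ • y) = 0 := by
        rw [map_smul, hy', smul_comm _ ν, ← sub_smul, smul_smul,
          mul_inv_cancel₀ (sub_ne_zero.mpr hν), one_smul, sub_self]
      rw [this]
      exact Submodule.zero_mem _
  | zero => exact ⟨0, Submodule.zero_mem _, by simp⟩
  | add y₁ y₂ h₁ h₂ ih₁ ih₂ =>
    obtain ⟨z₁, hz₁, hy₁⟩ := ih₁
    obtain ⟨z₂, hz₂, hy₂⟩ := ih₂
    refine ⟨z₁ + z₂, Submodule.add_mem _ hz₁ hz₂, ?_⟩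
    convert Submodule.add_mem _ hy₁ hy₂ using 1
    rw [map_add]
    module

/-- One linear factor is peeled off at a time. If `(B - μ) x` is a sum of eigenvectors, correcting
`x` by such a sum `z` makes `(B - μ)(x - z)` a `μ`-eigenvector, which vanishes because Jordan blocks
are trivial. -/
theorem HasTrivialJordanBlocks.mem_iSup_eigenspace {B : Module.End ℝ V}
    (hB : HasTrivialJordanBlocks B) (s : Multiset ℝ) {x : V}
    (hx : aeval B (s.map fun μ => X - C μ).prod x = 0) : x ∈ ⨆ ν, B.eigenspace ν := by
  induction s using Multiset.induction_on generalizing x with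
  | empty =>
    obtain rfl : x = 0 := by simpa using hx
    exact Submodule.zero_mem _
  | cons μ s ih =>
    rw [Multiset.map_cons, Multiset.prod_cons, mul_comm, map_mul, Module.End.mul_apply] at hx
    have hy := ih hx
    obtain ⟨z, hz, hzy⟩ := exists_sub_mem_eigenspace μ hy
    have hy' : aeval B (X - C μ) x = B x - μ • x := by
      simp [Module.algebraMap_end_apply]
    rw [hy', Module.End.mem_eigenspace_iff] at hzy
    have h0 := hB μ (x - z) _ (by rw [map_sub]; module) hzy
    have hxz : x - z ∈ B.eigenspace μ := by
      rw [Module.End.mem_eigenspace_iff, ← sub_eq_zero, ← h0, map_sub]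
      module
    have := Submodule.add_mem _ (Submodule.mem_iSup_of_mem (p := fun ν => B.eigenspace ν) μ hxz) hz
    rwa [sub_add_cancel] at this

theorem hasTrivialJordanBlocks_of_isSemisimple {B : Module.End ℝ V}
    (hB : B.IsSemisimple) : HasTrivialJordanBlocks B := by
  intro μ x y hx hy
  have hmem : x ∈ B.genEigenspace μ 2 := by
    rw [show (2 : ℕ∞) = ((2 : ℕ) : ℕ∞) from rfl, Module.End.mem_genEigenspace_nat,
      LinearMap.mem_ker, pow_two, Module.End.mul_apply]
    simp [hx, hy]
  rw [hB.isFinitelySemisimple.genEigenspace_eq_eigenspace μ (by norm_num),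
    Module.End.mem_eigenspace_iff, hx] at hmem
  simpa using hmem

variable [FiniteDimensional ℝ V]

theorem HasTrivialJordanBlocks.iSup_eigenspace_eq_top {B : Module.End ℝ V}
    (hB : HasTrivialJordanBlocks B)
    (hreal : ∀ z : ℂ, (B.charpoly.map (algebraMap ℝ ℂ)).IsRoot z → z.im = 0) :
    ⨆ μ, B.eigenspace μ = ⊤ := by
  have hmonic := LinearMap.charpoly_monic B
  have h1 := (IsAlgClosed.splits (B.charpoly.map (algebraMap ℝ ℂ))).eq_prod_roots_of_monic
    (hmonic.map _)
  have h2 : B.charpoly = (((B.charpoly.map (algebraMap ℝ ℂ)).roots.map Complex.re).map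
      fun μ => X - C μ).prod := by
    apply Polynomial.map_injective (algebraMap ℝ ℂ) (algebraMap ℝ ℂ).injective
    conv_lhs => rw [h1]
    rw [Polynomial.map_multiset_prod, Multiset.map_map, Multiset.map_map]
    congr 1
    refine Multiset.map_congr rfl fun z hz => ?_
    have hz' := hreal z (isRoot_of_mem_roots hz)
    have : ((z.re : ℝ) : ℂ) = z := Complex.ext rfl (by simp [hz'])
    simp [this]
  rw [eq_top_iff]
  intro x _
  refine hB.mem_iSup_eigenspace
    ((B.charpoly.map (algebraMap ℝ ℂ)).roots.map Complex.re) ?_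
  rw [← h2, LinearMap.aeval_self_charpoly, LinearMap.zero_apply]

theorem isSemisimple_of_iSup_eigenspace_eq_top {B : Module.End ℝ V}
    (hB : ⨆ μ, B.eigenspace μ = ⊤) : B.IsSemisimple := by
  let s : Finset ℝ := (minpoly ℝ B).roots.toFinset
  -- The product over distinct eigenvalues is squarefree and kills each eigenvector.
  refine Module.End.isSemisimple_of_squarefree_aeval_eq_zero (p := ∏ μ ∈ s, (X - C μ))
    (separable_prod_X_sub_C_iff' .. |>.mpr fun _ _ _ _ h => h).squarefree ?_
  ext x
  have hx : x ∈ ⨆ μ, B.eigenspace μ := hB ▸ Submodule.mem_top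
  induction hx using Submodule.iSup_induction' with
  | mem ν y hy =>
    by_cases hy0 : y = 0
    · rw [hy0, map_zero, map_zero]
    · have hev : B.HasEigenvector ν y := ⟨hy, hy0⟩
      have hroot := Module.End.isRoot_of_hasEigenvalue
        (Module.End.hasEigenvalue_of_hasEigenvector hev)
      have hmem : ν ∈ s := by
        rw [Multiset.mem_toFinset, mem_roots (minpoly.ne_zero (Algebra.IsIntegral.isIntegral B))]
        exact hroot
      rw [Module.End.aeval_apply_of_hasEigenvector hev, eval_prod,
        Finset.prod_eq_zero hmem (by simp), zero_smul, LinearMap.zero_apply]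
  | zero => rw [map_zero, map_zero]
  | add y₁ y₂ h₁ h₂ ih₁ ih₂ => rw [map_add, ih₁, ih₂, map_add]

end Diagonalizable

/-! ### Diagonalizable action implies hard Lefschetz -/

namespace SymplecticForm

variable {𝔤 : Type*} [LieRing 𝔤] [LieAlgebra ℝ 𝔤] [FiniteDimensional ℝ 𝔤] (ω : SymplecticForm 𝔤)

section Splitting

variable {τ : Module.Dual ℝ 𝔤} {f : 𝔤}

/-- The `k`-forms that are eigenvectors of the Lie derivative along `f`. -/
def eigenForms (f : 𝔤) (k : ℕ) : Set (Form 𝔤) :=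
  {α | α ∈ ⋀[ℝ]^k (Module.Dual ℝ 𝔤) ∧ ∃ μ : ℝ, lieDer f α = μ • α}

/-- `x ↦ ω(x, ·)` intertwines `ad f` with `L_f`, so eigenvectors become eigen-covectors, and weights
add under the wedge product. -/
theorem flat_mul_mem_span_eigenForms (hf : ∀ x y : 𝔤, ω.flat f ⁅x, y⁆ = 0)
    (hB : ⨆ μ, Module.End.eigenspace (LieAlgebra.ad ℝ 𝔤 f : 𝔤 →ₗ[ℝ] 𝔤) μ = ⊤) {k : ℕ} (x : 𝔤)
    {α : Form 𝔤} (hα : α ∈ Submodule.span ℝ (eigenForms f k)) :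
    oneForm (ω.flat x) * α ∈ Submodule.span ℝ (eigenForms f (k + 1)) := by
  have hx : x ∈ ⨆ μ, Module.End.eigenspace (LieAlgebra.ad ℝ 𝔤 f : 𝔤 →ₗ[ℝ] 𝔤) μ :=
    hB ▸ Submodule.mem_top
  induction hx using Submodule.iSup_induction' with
  | mem μ x hx =>
    rw [Module.End.mem_eigenspace_iff, LieAlgebra.ad_apply] at hx
    induction hα using Submodule.span_induction with
    | mem α hα =>
      obtain ⟨hαk, ν, hν⟩ := hα
      refine Submodule.subset_span ⟨oneForm_mul_mem hαk _, μ + ν, ?_⟩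
      rw [lieDer_mul, ω.lieDer_flat hf, hx, hν, oneForm, map_smul, map_smul, smul_mul_assoc,
        mul_smul_comm, add_smul]
    | zero => rw [mul_zero]; exact Submodule.zero_mem _
    | add a b _ _ ha hb => rw [mul_add]; exact Submodule.add_mem _ ha hb
    | smul c a _ ha => rw [mul_smul_comm]; exact Submodule.smul_mem _ _ ha
  | zero => rw [map_zero, oneForm, map_zero, zero_mul]; exact Submodule.zero_mem _
  | add a b _ _ ha hb =>
    rw [map_add, oneForm, map_add, add_mul]; exact Submodule.add_mem _ ha hb

theorem mem_span_eigenForms (hf : ∀ x y : 𝔤, ω.flat f ⁅x, y⁆ = 0)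
    (hB : ⨆ μ, Module.End.eigenspace (LieAlgebra.ad ℝ 𝔤 f : 𝔤 →ₗ[ℝ] 𝔤) μ = ⊤) {k : ℕ}
    {α : Form 𝔤} (hα : α ∈ ⋀[ℝ]^k (Module.Dual ℝ 𝔤)) :
    α ∈ Submodule.span ℝ (eigenForms f k) := by
  induction hα using Submodule.pow_induction_on_left' with
  | algebraMap r =>
    refine Submodule.subset_span ⟨?_, 0, ?_⟩
    · rw [ExteriorAlgebra.exteriorPower, pow_zero]
      exact Submodule.mem_one.mpr ⟨r, rfl⟩
    · rw [lieDer_algebraMap, zero_smul]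
  | add a b i ha hb h1 h2 => exact Submodule.add_mem _ h1 h2
  | mem_mul m hm i a ha h =>
    obtain ⟨η, rfl⟩ := hm
    obtain ⟨x, rfl⟩ := ω.exists_flat_eq η
    exact ω.flat_mul_mem_span_eigenForms hf hB x h

/-- Every `k`-form is the sum of an invariant form and a Lie derivative. -/
theorem exists_invariant_add_lieDer (hf : ∀ x y : 𝔤, ω.flat f ⁅x, y⁆ = 0)
    (hB : ⨆ μ, Module.End.eigenspace (LieAlgebra.ad ℝ 𝔤 f : 𝔤 →ₗ[ℝ] 𝔤) μ = ⊤) {k : ℕ}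
    {α : Form 𝔤} (hα : α ∈ ⋀[ℝ]^k (Module.Dual ℝ 𝔤)) :
    ∃ α₀ ∈ ⋀[ℝ]^k (Module.Dual ℝ 𝔤), ∃ γ ∈ ⋀[ℝ]^k (Module.Dual ℝ 𝔤),
      lieDer f α₀ = 0 ∧ α = α₀ + lieDer f γ := by
  have h := ω.mem_span_eigenForms hf hB hα
  clear hα
  induction h using Submodule.span_induction with
  | mem α hα =>
    obtain ⟨hαk, μ, hμ⟩ := hα
    by_cases h0 : μ = 0
    · exact ⟨α, hαk, 0, Submodule.zero_mem _, by rw [hμ, h0, zero_smul], by simp⟩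
    · exact ⟨0, Submodule.zero_mem _, μ⁻¹ • α, Submodule.smul_mem _ _ hαk, map_zero _, by
        rw [map_smul, hμ, smul_smul, inv_mul_cancel₀ h0, one_smul, zero_add]⟩
  | zero => exact ⟨0, Submodule.zero_mem _, 0, Submodule.zero_mem _, map_zero _, by simp⟩
  | add a b _ _ ha hb =>
    obtain ⟨a₀, ha₀, γ, hγ, ha, rfl⟩ := ha
    obtain ⟨b₀, hb₀, δ, hδ, hb, rfl⟩ := hb
    refine ⟨a₀ + b₀, Submodule.add_mem _ ha₀ hb₀, γ + δ, Submodule.add_mem _ hγ hδ, ?_, ?_⟩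
    · rw [map_add, ha, hb, add_zero]
    · rw [map_add]; abel
  | smul c a _ ha =>
    obtain ⟨a₀, ha₀, γ, hγ, ha, rfl⟩ := ha
    refine ⟨c • a₀, Submodule.smul_mem _ _ ha₀, c • γ, Submodule.smul_mem _ _ hγ, ?_, ?_⟩
    · rw [map_smul, ha, smul_zero]
    · rw [map_smul, smul_add]

/-- An invariant form that is a Lie derivative vanishes. -/
theorem lieDer_eq_zero_of_lieDer_lieDer_eq_zero (hf : ∀ x y : 𝔤, ω.flat f ⁅x, y⁆ = 0)
    (hB : ⨆ μ, Module.End.eigenspace (LieAlgebra.ad ℝ 𝔤 f : 𝔤 →ₗ[ℝ] 𝔤) μ = ⊤) {k : ℕ}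
    {γ : Form 𝔤} (hγ : γ ∈ ⋀[ℝ]^k (Module.Dual ℝ 𝔤)) (h : lieDer f (lieDer f γ) = 0) :
    lieDer f γ = 0 := by
  let T : ⋀[ℝ]^k (Module.Dual ℝ 𝔤) →ₗ[ℝ] ⋀[ℝ]^k (Module.Dual ℝ 𝔤) :=
    (lieDer f).restrict fun α hα => lieDer_mem f hα
  have hsup : LinearMap.range T ⊔ LinearMap.ker T = ⊤ := by
    rw [eq_top_iff]
    rintro ⟨α, hα⟩ -
    obtain ⟨α₀, hα₀, γ, hγ, h0, rfl⟩ := ω.exists_invariant_add_lieDer hf hB hα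
    rw [sup_comm]
    exact Submodule.mem_sup.mpr ⟨⟨α₀, hα₀⟩, Subtype.ext h0, T ⟨γ, hγ⟩,
      LinearMap.mem_range_self _ _, rfl⟩
  -- Image and kernel already span, so rank-nullity forces them to intersect trivially.
  have h1 := Submodule.finrank_sup_add_finrank_inf_eq (LinearMap.range T) (LinearMap.ker T)
  rw [LinearMap.finrank_range_add_finrank_ker, hsup, finrank_top] at h1
  have h2 : LinearMap.range T ⊓ LinearMap.ker T = ⊥ := Submodule.finrank_eq_zero.mp (by omega)
  have h3 : T ⟨γ, hγ⟩ ∈ LinearMap.range T ⊓ LinearMap.ker T :=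
    ⟨LinearMap.mem_range_self _ _, Subtype.ext h⟩
  rw [h2, Submodule.mem_bot] at h3
  exact congrArg Subtype.val h3

/-- Every closed form is cohomologous to an invariant form. -/
theorem exists_invariant_sub_mem_exactForms (h : IsSplitting τ f)
    (hf : ∀ x y : 𝔤, ω.flat f ⁅x, y⁆ = 0)
    (hB : ⨆ μ, Module.End.eigenspace (LieAlgebra.ad ℝ 𝔤 f : 𝔤 →ₗ[ℝ] 𝔤) μ = ⊤) {k : ℕ}
    {α : Form 𝔤} (hα : α ∈ closedForms 𝔤 k) :
    ∃ α₀ ∈ ⋀[ℝ]^k (Module.Dual ℝ 𝔤), lieDer f α₀ = 0 ∧ α - α₀ ∈ exactForms 𝔤 k := by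
  obtain ⟨hαk, hd⟩ := hα
  obtain ⟨α₀, hα₀, γ, hγ, h0, rfl⟩ := ω.exists_invariant_add_lieDer hf hB hαk
  refine ⟨α₀, hα₀, h0, ?_⟩
  rw [add_sub_cancel_left]
  rw [SetLike.mem_coe, LinearMap.mem_ker, map_add, h.d_eq, h0, mul_zero, zero_add, h.d_eq,
    ← h.lieDer_covector_mul, ← h.lieDer_covector_mul] at hd
  -- Closedness reads `L_f² (τ ∧ γ) = 0`, hence `τ ∧ L_f γ = 0`. Contracting with `f` then yields
  -- `L_f γ = τ ∧ L_f (ι_f γ) = d (ι_f γ)`.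
  have h1 := ω.lieDer_eq_zero_of_lieDer_lieDer_eq_zero hf hB (oneForm_mul_mem hγ τ) hd
  rw [h.lieDer_covector_mul] at h1
  have h2 := contr_oneForm_mul f τ (lieDer f γ)
  rw [h1, map_zero, h.apply_self, one_smul, ← lieDer_contr_self, ← h.d_eq] at h2
  refine mem_exactForms.mpr ?_
  cases k with
  | zero =>
    obtain ⟨r, rfl⟩ := exists_algebraMap_of_mem_zero hγ
    exact Or.inl (lieDer_algebraMap f r)
  | succ k => exact Or.inr ⟨k, rfl, contr f γ, contr_mem hγ f, (sub_eq_zero.mp h2.symm).symm⟩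

/-- An exact form is `dβ = L_f (τ ∧ β)`, so it lies in the image of `L_f`, which meets the kernel
trivially. Invariant representatives are therefore unique. -/
theorem eq_zero_of_invariant_of_mem_exactForms (h : IsSplitting τ f)
    (hf : ∀ x y : 𝔤, ω.flat f ⁅x, y⁆ = 0)
    (hB : ⨆ μ, Module.End.eigenspace (LieAlgebra.ad ℝ 𝔤 f : 𝔤 →ₗ[ℝ] 𝔤) μ = ⊤) {k : ℕ}
    {α : Form 𝔤} (hα : α ∈ exactForms 𝔤 k) (h0 : lieDer f α = 0) : α = 0 := by
  rcases mem_exactForms.mp hα with h1 | ⟨j, -, β, hβ, rfl⟩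
  · exact h1
  · rw [h.d_eq, ← h.lieDer_covector_mul] at h0 ⊢
    exact ω.lieDer_eq_zero_of_lieDer_lieDer_eq_zero hf hB (oneForm_mul_mem hβ τ) h0

theorem hardLefschetz_of_iSup_eigenspace_eq_top (h : IsSplitting τ f)
    (hf : ∀ x y : 𝔤, ω.flat f ⁅x, y⁆ = 0)
    (hB : ⨆ μ, Module.End.eigenspace (LieAlgebra.ad ℝ 𝔤 f : 𝔤 →ₗ[ℝ] 𝔤) μ = ⊤) :
    ω.HardLefschetz := by
  have hT := ω.lieDer_form_eq_zero hf
  have hclosed : ∀ {α}, lieDer f α = 0 → d α = 0 := fun h0 => by rw [h.d_eq, h0, mul_zero]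
  have hmul : ∀ {r p : ℕ} {α : Form 𝔤}, α ∈ exactForms 𝔤 p →
      ω.form ^ r * α ∈ exactForms 𝔤 (p + 2 * r) := fun {r p α} hα => by
    rcases mem_exactForms.mp hα with rfl | ⟨j, hj, β, hβ, rfl⟩
    · rw [mul_zero]; exact Submodule.zero_mem _
    · exact mem_exactForms.mpr (Or.inr ⟨j + 2 * r, by omega, ω.form ^ r * β,
        ω.pow_mul_mem r hβ, ω.d_pow_mul r β⟩)
  intro r p hrp
  refine ⟨(ω.lefschetz_injective_iff r p).mpr fun α hα hex => ?_,
    ω.lefschetz_surjective_of_exists fun β hβ => ?_⟩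
  · obtain ⟨α₀, hα₀, h0, hsub⟩ := ω.exists_invariant_sub_mem_exactForms h hf hB hα
    have h1 : ω.form ^ r * α₀ ∈ exactForms 𝔤 (p + 2 * r) := by
      have := Submodule.sub_mem _ hex (hmul (r := r) hsub)
      rwa [← mul_sub, sub_sub_cancel] at this
    have h2 := ω.eq_zero_of_invariant_of_mem_exactForms h hf hB h1
      (by rw [ω.lieDer_pow_mul hT, h0, mul_zero])
    rwa [ω.eq_zero_of_pow_mul_eq_zero hrp.symm le_rfl hα₀ h2, sub_zero] at hsub
  · obtain ⟨β₀, hβ₀, h0, hsub⟩ := ω.exists_invariant_sub_mem_exactForms h hf hB hβ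
    obtain ⟨α, hα, rfl⟩ := ω.exists_pow_mul_eq hrp hβ₀
    rw [ω.lieDer_pow_mul hT] at h0
    -- Since `ωʳ ∧ L_f α = L_f β₀ = 0`, injectivity on forms makes the preimage `α` invariant, hence
    -- closed.
    have h1 := ω.eq_zero_of_pow_mul_eq_zero hrp.symm le_rfl (lieDer_mem f hα) h0
    refine ⟨α, ⟨hα, hclosed h1⟩, ?_⟩
    rw [← neg_sub]
    exact Submodule.neg_mem _ hsub

end Splitting

end SymplecticForm

/-! ### From the structure matrix to the splitting and back -/

section StructureMatrix

variable {𝔤 : Type*} [LieRing 𝔤] [LieAlgebra ℝ 𝔤]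

/-- `e` identifies `ℝᵐ` with the kernel of `τ`, on which `f` acts by the matrix `A`. -/
structure IsStructureMatrix (τ : Module.Dual ℝ 𝔤) (f : 𝔤) {m : ℕ}
    (A : Matrix (Fin m) (Fin m) ℝ) (e : (Fin m → ℝ) →ₗ[ℝ] 𝔤) : Prop where
  injective : Function.Injective e
  range_eq : LinearMap.range e = LinearMap.ker τ
  lie_apply : ∀ x, ⁅f, e x⁆ = e (Matrix.toLin' A x)

theorem IsAlmostAbelian.exists_splitting [FiniteDimensional ℝ 𝔤] {m : ℕ}
    {A : Matrix (Fin m) (Fin m) ℝ} (hA : IsAlmostAbelian 𝔤 A) :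
    ∃ τ f e, IsSplitting (𝔤 := 𝔤) τ f ∧ IsStructureMatrix τ f A e := by
  obtain ⟨𝔲, f, b, hab, hcodim, hf, hb⟩ := hA
  obtain ⟨φ, hφf, hφ⟩ := Submodule.exists_le_ker_of_notMem (p := 𝔲.toSubmodule) hf
  let τ : Module.Dual ℝ 𝔤 := (φ f)⁻¹ • φ
  have hτf : τ f = 1 := inv_mul_cancel₀ hφf
  have hle : 𝔲.toSubmodule ≤ LinearMap.ker τ := fun x hx => by
    have : φ x = 0 := hφ hx
    simp [τ, this]
  have hker : 𝔲.toSubmodule = LinearMap.ker τ := by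
    refine Submodule.eq_of_le_of_finrank_eq hle ?_
    have h1 : Module.finrank ℝ (𝔤 ⧸ 𝔲.toSubmodule) + _ = _ :=
      Submodule.finrank_quotient_add_finrank 𝔲.toSubmodule
    have h2 := LinearMap.finrank_range_add_finrank_ker τ
    have h3 : LinearMap.range τ = ⊤ := LinearMap.range_eq_top.mpr fun c =>
      ⟨c • f, by rw [map_smul, hτf, smul_eq_mul, mul_one]⟩
    have h4 : Module.finrank ℝ (𝔤 ⧸ 𝔲.toSubmodule) = 1 := hcodim
    rw [h3, finrank_top, Module.finrank_self] at h2
    omega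
  have hmem : ∀ x, x ∈ 𝔲 ↔ τ x = 0 := fun x => by
    rw [← LieSubmodule.mem_toSubmodule, hker, LinearMap.mem_ker]
  have hzero : ∀ x y, τ x = 0 → τ y = 0 → ⁅x, y⁆ = 0 := fun x y hx hy => by
    have := hab.trivial ⟨x, (hmem x).mpr hx⟩ ⟨y, (hmem y).mpr hy⟩
    exact congrArg Subtype.val this
  have hsub : ∀ x, τ (x - τ x • f) = 0 := fun x => by
    rw [map_sub, map_smul, hτf, smul_eq_mul, mul_one, sub_self]
  let e : (Fin m → ℝ) →ₗ[ℝ] 𝔤 := 𝔲.toSubmodule.subtype ∘ₗ b.equivFun.symm.toLinearMap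
  have he : ∀ x, e x = ∑ i, x i • (b i : 𝔤) := fun x => by
    simp [e, Module.Basis.equivFun_symm_apply]
  refine ⟨τ, f, e, ⟨hτf, fun x => ?_, fun x y => ?_⟩, ⟨?_, ?_, fun x => ?_⟩⟩
  · have h1 : ⁅f, x - τ x • f⁆ ∈ 𝔲 := lie_mem_right ℝ 𝔤 𝔲 _ _ ((hmem _).mpr (hsub x))
    rw [lie_sub, lie_smul, lie_self, smul_zero, sub_zero] at h1
    exact (hmem _).mp h1
  · have h1 := hzero _ _ (hsub x) (hsub y)
    rw [sub_lie, lie_sub, lie_sub, smul_lie, smul_lie, lie_smul, lie_smul, lie_self,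
      ← lie_skew x f] at h1
    rw [← sub_eq_zero, ← h1]
    module
  · exact (Submodule.injective_subtype _).comp b.equivFun.symm.injective
  · rw [LinearMap.range_comp, LinearEquiv.range, Submodule.map_top, Submodule.range_subtype, hker]
  · rw [he, he, lie_sum]
    simp only [lie_smul, hb, Finset.smul_sum, Matrix.toLin'_apply, Matrix.mulVec, dotProduct,
      Finset.sum_smul]
    rw [Finset.sum_comm]
    refine Finset.sum_congr rfl fun i _ => Finset.sum_congr rfl fun j _ => ?_
    rw [smul_smul, mul_comm]

namespace IsStructureMatrix

variable {τ : Module.Dual ℝ 𝔤} {f : 𝔤} {m : ℕ} {A : Matrix (Fin m) (Fin m) ℝ}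
  {e : (Fin m → ℝ) →ₗ[ℝ] 𝔤} (h : IsStructureMatrix τ f A e)
include h

/-- This transfers `A` unchanged to the adapted `f'`. -/
theorem of_lie_eq {f' : 𝔤} (hf' : ∀ x, τ x = 0 → ⁅f', x⁆ = ⁅f, x⁆) :
    IsStructureMatrix τ f' A e where
  injective := h.injective
  range_eq := h.range_eq
  lie_apply x := by
    rw [hf' _ (h.range_eq.le (LinearMap.mem_range_self e x)), h.lie_apply]

theorem exists_eq {x : 𝔤} (hx : τ x = 0) : ∃ u, e u = x :=
  h.range_eq.ge hx

/-- `ad f` maps into `ker τ`, so a block with `μ ≠ 0` lies inside `ker τ`. For `μ = 0`, subtracting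
`τ x • f` moves `x` into `ker τ` without changing `[f, x]`. -/
theorem hasTrivialJordanBlocks_ad (hs : IsSplitting τ f) (hA : IsSemisimpleMatrix A) :
    HasTrivialJordanBlocks (LieAlgebra.ad ℝ 𝔤 f : 𝔤 →ₗ[ℝ] 𝔤) := by
  have hJ := hasTrivialJordanBlocks_of_isSemisimple hA
  have key : ∀ (μ : ℝ) (x y : 𝔤), τ x = 0 → τ y = 0 → ⁅f, x⁆ = μ • x + y → ⁅f, y⁆ = μ • y →
      y = 0 := by
    intro μ x y hx hy hxy hyy
    obtain ⟨x, rfl⟩ := h.exists_eq hx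
    obtain ⟨y, rfl⟩ := h.exists_eq hy
    rw [h.lie_apply, ← map_smul] at hxy hyy
    rw [← map_add] at hxy
    rw [hJ μ x y (h.injective hxy) (h.injective hyy), map_zero]
  intro μ x y hx hy
  rw [LieAlgebra.ad_apply] at hx hy
  have hτx := congrArg τ hx
  have hτy := congrArg τ hy
  rw [hs.apply_lie, map_add, map_smul, smul_eq_mul] at hτx
  rw [hs.apply_lie, map_smul, smul_eq_mul] at hτy
  by_cases hμ : μ = 0
  · subst hμ
    refine key 0 (x - τ x • f) y ?_ (by linarith) ?_ hy
    · rw [map_sub, map_smul, hs.apply_self, smul_eq_mul, mul_one, sub_self]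
    · rw [lie_sub, lie_smul, lie_self, hx]
      simp
  · have hy0 : τ y = 0 := (mul_eq_zero.mp hτy.symm).resolve_left hμ
    rw [hy0, add_zero] at hτx
    exact key μ x y ((mul_eq_zero.mp hτx.symm).resolve_left hμ) hy0 hx hy

/-- Through `e`, the matrix `A` is the restriction of `ad f` to an invariant subspace, and
semisimplicity passes to restrictions. -/
theorem isSemisimpleMatrix [FiniteDimensional ℝ 𝔤]
    (hB : Module.End.IsSemisimple (LieAlgebra.ad ℝ 𝔤 f : 𝔤 →ₗ[ℝ] 𝔤)) :
    IsSemisimpleMatrix A := by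
  have hinv : LinearMap.range e ∈
      Module.End.invtSubmodule (LieAlgebra.ad ℝ 𝔤 f : 𝔤 →ₗ[ℝ] 𝔤) := by
    rintro _ ⟨x, rfl⟩
    exact ⟨Matrix.toLin' A x, (h.lie_apply x).symm⟩
  refine ((LinearEquiv.ofInjective e h.injective).isSemisimple_iff (Matrix.toLin' A) _ ?_).mpr
    (hB.restrict hinv)
  exact LinearMap.ext fun x => Subtype.ext (h.lie_apply x).symm

end IsStructureMatrix

end StructureMatrix

end

end LieForm

/-! ### The equivalence -/

theorem theorem4p14 {𝔤 : Type*} [LieRing 𝔤] [LieAlgebra ℝ 𝔤] [FiniteDimensional ℝ 𝔤]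
    {m : ℕ} (A : Matrix (Fin m) (Fin m) ℝ) (hA : LieForm.IsAlmostAbelian 𝔤 A)
    (hU : LieForm.IsUnimodular 𝔤) (hS : LieForm.IsCompletelySolvable 𝔤)
    (ω : LieForm.SymplecticForm 𝔤) :
    ω.HardLefschetz ↔ LieForm.IsSemisimpleMatrix A := by
  obtain ⟨τ, f, e, hs, he⟩ := hA.exists_splitting
  obtain ⟨v, hv⟩ := ω.exists_flat_eq τ
  have hfv := ω.lie_dual_vector hs hv (hU f)
  have hv0 : v ≠ 0 := by
    rintro rfl
    have := hs.apply_self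
    rw [← hv] at this
    simp at this
  constructor
  · intro H
    obtain ⟨f', hs', hω, hf'⟩ :=
      ω.exists_adapted_splitting hs hv (ω.lie_ne_dual_vector H hs hv hfv)
    have hJ := ω.hasTrivialJordanBlocks_of_hardLefschetz H hs' hv hω
    exact (he.of_lie_eq hf').isSemisimpleMatrix (LieForm.isSemisimple_of_iSup_eigenspace_eq_top
      (hJ.iSup_eigenspace_eq_top (hS.2 f')))
  · intro hss
    -- `[f, w] = v` and `[f, v] = 0` would form a Jordan block of eigenvalue `0`.
    have hw : ∀ w, ⁅f, w⁆ ≠ v := fun w hw => hv0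
      (he.hasTrivialJordanBlocks_ad hs hss 0 w v (by simpa using hw) (by simpa using hfv))
    obtain ⟨f', hs', hω, hf'⟩ := ω.exists_adapted_splitting hs hv hw
    have hJ := (he.of_lie_eq hf').hasTrivialJordanBlocks_ad hs' hss
    exact ω.hardLefschetz_of_iSup_eigenspace_eq_top hs' hω
      (hJ.iSup_eigenspace_eq_top (hS.2 f'))
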